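/- **Processes.** $P ::= c[r]\oplus_{i\in I}\langle p_i:l_i(v_i);P_i\rangle \mid c[r]\,\&_{i\in I}\{l_i(x_i);P_i\} \mid (\nu s:G)P \mid \mathsf{def}\ D\ \mathsf{in}\ P \mid X(\tilde v\,\tilde c)\mid \mathbf 0\mid P\mid P$, with $D$ of the form $X(\tilde x\,\tilde y)=P$, where $I$ is finite and non-empty, the labels $l_i$ are pairwise distinct and their order is irrelevant, $r$ is a role, a channel $c$ is a channel variable or a channel with role $s[r]$ of a session $s$, and values $v$ are variables, session names and literals. In a declaration $D$, $\tilde x$ are the value parameters and $\tilde y$ the channel parameters; in well-typed processes declarations are closed (the body has no other free variables and no free channel with role). Processes are taken up to renaming of bound names. **Structural congruence** $\equiv$ is the least congruence with $P\mid Q\equiv Q\mid P$, $(P\mid Q)\mid R\equiv P\mid(Q\mid R)$, $P\mid\mathbf 0\equiv P$, $(\nu s:G)\mathbf 0\equiv\mathbf 0$, $(\nu s:G)(\nu s':G')P\equiv(\nu s':G')(\nu s:G)P$, $(\nu s:G)P\mid Q\equiv(\nu s:G)(P\mid Q)$ if $s$ is not free in $Q$, $\mathsf{def}\ D\ \mathsf{in}\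 \mathbf 0\equiv\mathbf 0$, $\mathsf{def}\ D\ \mathsf{in}\ (\nu s:G)P\equiv(\nu s:G)\,\mathsf{def}\ D\ \mathsf{in}\ P$ if $s$ is not free in $D$, $\mathsf{def}\ D\ \mathsf{in}\ (P\mid Q)\equiv(\mathsf{def}\ D\ \mathsf{in}\ P)\mid Q$ if the process variable declared in $D$ is not free in $Q$, and $\mathsf{def}\ D\ \mathsf{in}\ \mathsf{def}\ D'\ \mathsf{in}\ P\equiv\mathsf{def}\ D'\ \mathsf{in}\ \mathsf{def}\ D\ \mathsf{in}\ P$ if $D$ and $D'$ declare distinct process variables and neither variable is free in the other declaration. **Reduction** $P\xrightarrow{tl}_p P'$ is generated by: * $s[r_1][r_2]\oplus_{j\in J}\langle p_j:l_j(v_j);P_j\rangle\mid s[r_2][r_1]\,\&_{i\in I}\{l_i(x_i);P'_i\}\xrightarrow{(r_1,r_2,l_k)}_{p_k}P_k\mid P'_k\{v_k/x_k\}$ for $k\in J\subseteq I$; * $\mathsf{def}\ X(\tilde x\tilde y)=R\ \mathsf{in}\ (X(\tilde v\tilde c)\mid Q)\xrightarrow{\varepsilon}_1\mathsf{def}\ X(\tilde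 x\tilde y)=R\ \mathsf{in}\ (R\{\tilde v\tilde c/\tilde x\tilde y\}\mid Q)$, if the numbers of parameters agree; * if $P\xrightarrow{tl}_pP'$ then $\mathcal E[P]\xrightarrow{tl}_{p'}\mathcal E[P']$ with $p'=p\cdot nextProc(P)/nextProc(\mathcal E[P])$, for each one-hole evaluation context $\mathcal E$ built from restriction, definition and parallel composition, where $nextProc$ counts the communications (disjoint pairs of an unguarded selection and an unguarded branching with matching session and roles) and calls (of declared process variables) that a process can perform; * if $P\equiv P'\xrightarrow{tl}_pQ'\equiv Q$ then $P\xrightarrow{tl}_pQ$. A process is *stuck* ($P\not\rightarrow$) if it has no reduction, and $P\to^*P'$ means that $P$ reduces to $P'$ by finitely many (possibly zero) reductions, with any labels and probabilities. **Types.** Global types are $G::=r_1\to r_2:\{\delta_i:l_i(S_i).G_i\}_{i\in I}\mid\mu t.G\mid t\mid\mathsf{end}$ and local types are $T::=r\oplus_{i\in I}\delta_i:!l_i\langle S_i\rangle.T_i\mid r\,\&_{i\in I}\,?l_i(S_i).T_i\mid\mu t.T\mid t\mid\mathsf{end}$, with $I\neq\emptyset$ finite, distinct labels, recursion guarded, $S_i$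 base types and $\delta_i=[d_{1i},d_{2i}]\subseteq[0,1]$ non-empty intervals. The projection $G\upharpoonright r$ is the partial function given by: $(r_1\to r_2:\{\delta_i:l_i(S_i).G_i\})\upharpoonright r$ is $r_2\oplus_i\delta_i:!l_i\langle S_i\rangle.(G_i\upharpoonright r)$ if $r=r_1\ne r_2$, is $r_1\&_i\,?l_i(S_i).(G_i\upharpoonright r)$ if $r=r_2\neq r_1$, and is the common value of all $G_i\upharpoonright r$ if $r\notin\{r_1,r_2\}$ (undefined if they differ); $(\mu t.G)\upharpoonright r$ is $\mathsf{end}$ if $G\upharpoonright r=\mathsf{end}$ and otherwise $\mu t.(G\upharpoonright r)$, provided that this is a guarded type; $t\upharpoonright r=t$; $\mathsf{end}\upharpoonright r=\mathsf{end}$. Let $pid(G)$ be the set of roles occurring in $G$. $G$ is well-formed if it is closed and guarded, $G\upharpoonright r$ is defined for all $r\in pid(G)$, and each family $(\delta_i)_{i\in I}$ in it is reachable: $\sum_{j\ne i}d_{1j}+d_{2i}\le1\le\sum_{j\neq i}d_{2j}+d_{1i}$ for all $i$. **Typing.** A sorting $\Gamma$ assigns base types to value variables and sequences $\tilde S\tilde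 T$ to process variables; a typing $\Delta$ is a partial map from channels to local types, and $\Delta,\Delta'$ is disjoint union. Local types are identified with their unfoldings (equi-recursively). The judgement $\Gamma\vdash P\rhd\Delta$ is given by: * if $\Gamma\vdash v_i:S_i$, $\Gamma\vdash P_i\rhd\Delta,c:T_i$ and $p_i\in\delta_i$ for all $i\in I$, and $\sum_{i\in I}p_i=1$, then $\Gamma\vdash c[r]\oplus_{i\in I}\langle p_i:l_i(v_i);P_i\rangle\rhd\Delta,c:r\oplus_{i\in I}\delta_i:!l_i\langle S_i\rangle.T_i$; * if $\Gamma,x_i:S_i\vdash P_i\rhd\Delta,c:T_i$ for all $i\in I$, then $\Gamma\vdash c[r]\&_{i\in I}\{l_i(x_i);P_i\}\rhd\Delta,c:r\,\&_{i\in I}?l_i(S_i).T_i$; * $\Gamma\vdash\mathbf 0\rhd\Delta$ if all types in $\Delta$ are $\mathsf{end}$; * if $\Gamma\vdash P\rhd\Delta$ and $\Gamma\vdash Q\rhd\Delta'$, then $\Gamma\vdash P\mid Q\rhd\Delta,\Delta'$; * if $G$ is well-formed and $\Gamma\vdash P\rhd\Delta,\{s[r]:G\upharpoonright r\}_{r\in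 pid(G)}$, then $\Gamma\vdash(\nu s:G)P\rhd\Delta$; * if $\Gamma,\tilde x:\tilde S,X:\tilde S\tilde T\vdash R\rhd\tilde y:\tilde T$ and $\Gamma,X:\tilde S\tilde T\vdash Q\rhd\Delta$, then $\Gamma\vdash\mathsf{def}\ X(\tilde x\tilde y)=R\ \mathsf{in}\ Q\rhd\Delta$; * if $\Gamma\vdash\tilde v:\tilde S$ and all types in $\Delta$ are $\mathsf{end}$, then $\Gamma,X:\tilde S\tilde T\vdash X(\tilde v\tilde c)\rhd\Delta,\tilde c:\tilde T$. **Theorem (deadlock freedom).** Let $\emptyset\vdash P\rhd\emptyset$, where $P\equiv(\nu s:G)\,\|_{i\in I}P_i$ for a global type $G$ and a finite family of processes $P_i$, each of which interacts only on $s[r_i]$ for some role $r_i$, i.e. $s[r_i]$ is the only channel with role that occurs in $P_i$ (free or bound, including in continuations and declarations). Then $P$ is deadlock-free: if $P\to^*P'\not\rightarrow$ then $P'\equiv\mathbf 0$. -/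

import Mathlib

/-!
Probabilistic multiparty session calculus.

Binding is represented by de Bruijn indices, so alpha-equivalent terms are equal. There are four
separate families of indices for processes: session names (bound by restriction), value variables
and channel variables (bound as formal parameters; value variables are also bound by branching),
and process variables (bound by process definitions). Types have one family of type variables.
Finite families indexed by pairwise distinct labels, whose order is irrelevant, are functions on
a finite set of labels.
-/

namespace PMST

/-- Roles. -/
abbrev Role := ℕ

/-- Message labels. -/
abbrev Label := ℕ

/-- Base types. -/
inductive Srt where
  | bool | nat | int | string | session

/-- An imprecise probability `[lo, hi]` with `0 ≤ lo ≤ hi ≤ 1`. -/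
structure IProb where
  lo : ℝ
  hi : ℝ
  lo_nonneg : 0 ≤ lo
  lo_le_hi : lo ≤ hi
  hi_le_one : hi ≤ 1

/-- A finite family of imprecise probabilities is reachable. -/
def Reachable {I : Finset Label} (δ : {l // l ∈ I} → IProb) : Prop :=
  ∀ i, (∑ j ∈ Finset.univ.erase i, (δ j).lo) + (δ i).hi ≤ 1 ∧
    1 ≤ (∑ j ∈ Finset.univ.erase i, (δ j).hi) + (δ i).lo

/-- Lifting of a renaming of indices under one binder. -/
def up (f : ℕ → ℕ) : ℕ → ℕ
  | 0 => 0
  | n + 1 => f n + 1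

/-- Exchange of the two innermost binders. -/
def swap01 : ℕ → ℕ
  | 0 => 1
  | 1 => 0
  | n + 2 => n + 2

/-! ### Global and local types -/

/-- Global types: `comm r₁ r₂` is the interaction `r₁ → r₂ : {δᵢ : lᵢ(Sᵢ).Gᵢ}`, and `mu` binds
the type variable of index `0`. -/
inductive GType where
  | comm (r₁ r₂ : Role) (I : Finset Label) (hI : I.Nonempty) (δ : {l // l ∈ I} → IProb)
      (S : {l // l ∈ I} → Srt) (G : {l // l ∈ I} → GType)
  | mu (G : GType)
  | tvar (t : ℕ)
  | fin

/-- Local types: selection towards a role, branching from a role, recursion, variable, end. -/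
inductive LType where
  | sel (r : Role) (I : Finset Label) (hI : I.Nonempty) (δ : {l // l ∈ I} → IProb)
      (S : {l // l ∈ I} → Srt) (T : {l // l ∈ I} → LType)
  | bra (r : Role) (I : Finset Label) (hI : I.Nonempty)
      (S : {l // l ∈ I} → Srt) (T : {l // l ∈ I} → LType)
  | mu (T : LType)
  | tvar (t : ℕ)
  | fin

namespace GType

/-- The participants of a global type. -/
def pid : GType → Finset Role
  | comm r₁ r₂ _ _ _ _ G => {r₁, r₂} ∪ Finset.univ.biUnion (fun i => (G i).pid)
  | mu G => G.pid
  | tvar _ => ∅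
  | fin => ∅

/-- The type variable of index `k` occurs outside of every prefix. -/
def Exposed : ℕ → GType → Prop
  | _, comm _ _ _ _ _ _ _ => False
  | k, mu G => G.Exposed (k + 1)
  | k, tvar t => t = k
  | _, fin => False

/-- Every recursion variable is guarded, i.e. it occurs only under a prefix. -/
def Guarded : GType → Prop
  | comm _ _ _ _ _ _ G => ∀ i, (G i).Guarded
  | mu G => ¬ G.Exposed 0 ∧ G.Guarded
  | tvar _ => True
  | fin => True

/-- All free type variables have an index below `k`. -/
def ClosedAt : ℕ → GType → Prop
  | k, comm _ _ _ _ _ _ G => ∀ i, (G i).ClosedAt k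
  | k, mu G => G.ClosedAt (k + 1)
  | k, tvar t => t < k
  | _, fin => True

/-- All families of imprecise probabilities in the type are reachable. -/
def AllReachable : GType → Prop
  | comm _ _ _ _ δ _ G => Reachable δ ∧ ∀ i, (G i).AllReachable
  | mu G => G.AllReachable
  | tvar _ => True
  | fin => True

end GType

namespace LType

/-- The type variable of index `k` occurs outside of every prefix. -/
def Exposed : ℕ → LType → Prop
  | _, sel _ _ _ _ _ _ => False
  | _, bra _ _ _ _ _ => False
  | k, mu T => T.Exposed (k + 1)
  | k, tvar t => t = k
  | _, fin => False

/-- Renaming of type variables. -/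
def ren : (ℕ → ℕ) → LType → LType
  | f, sel r I hI δ S T => sel r I hI δ S (fun i => (T i).ren f)
  | f, bra r I hI S T => bra r I hI S (fun i => (T i).ren f)
  | f, mu T => mu (T.ren (up f))
  | f, tvar t => tvar (f t)
  | _, fin => fin

/-- Lifting of a substitution of types under one recursion binder. -/
def upSubst (σ : ℕ → LType) : ℕ → LType
  | 0 => tvar 0
  | n + 1 => (σ n).ren Nat.succ

/-- Capture-avoiding simultaneous substitution of types for type variables. -/
def subst : (ℕ → LType) → LType → LType
  | σ, sel r I hI δ S T => sel r I hI δ S (fun i => (T i).subst σ)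
  | σ, bra r I hI S T => bra r I hI S (fun i => (T i).subst σ)
  | σ, mu T => mu (T.subst (upSubst σ))
  | σ, tvar t => σ t
  | _, fin => fin

/-- `T.inst U` is `T{U/t}`, where `t` is the type variable of index `0`. -/
def inst (T U : LType) : LType :=
  T.subst (fun n => match n with
    | 0 => U
    | k + 1 => tvar k)

/-- `HeadsTo T U`: unfolding the recursions at the top of `T` gives `U`, which is not a recursion. -/
inductive HeadsTo : LType → LType → Prop where
  | sel (r I hI δ S T) : HeadsTo (sel r I hI δ S T) (sel r I hI δ S T)
  | bra (r I hI S T) : HeadsTo (bra r I hI S T) (bra r I hI S T)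
  | tvar (t) : HeadsTo (tvar t) (tvar t)
  | fin : HeadsTo fin fin
  | mu {T U : LType} : HeadsTo (T.inst (mu T)) U → HeadsTo (mu T) U

/-- Two types have the same outermost constructor, with continuations related by `R`. -/
inductive SameHead (R : LType → LType → Prop) : LType → LType → Prop where
  | sel (r I hI δ S) {T T' : _ → LType} : (∀ i, R (T i) (T' i)) →
      SameHead R (sel r I hI δ S T) (sel r I hI δ S T')
  | bra (r I hI S) {T T' : _ → LType} : (∀ i, R (T i) (T' i)) →
      SameHead R (bra r I hI S T) (bra r I hI S T')
  | tvar (t) : SameHead R (tvar t) (tvar t)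
  | fin : SameHead R fin fin

/-- Equi-recursive equality of local types: equality of the infinite unfoldings
(the largest bisimulation). -/
def Equiv (T T' : LType) : Prop :=
  ∃ R : LType → LType → Prop, R T T' ∧
    ∀ A B, R A B → ∃ A' B', HeadsTo A A' ∧ HeadsTo B B' ∧ SameHead R A' B'

end LType

/-- `Proj G r T`: the projection of `G` onto the role `r` is defined and equal to `T`.
In the clause for recursion the result has to be a local type, hence guarded. -/
inductive Proj : GType → Role → LType → Prop where
  | send {r₁ r₂ : Role} {I hI δ S} {G : {l // l ∈ I} → GType} {T : {l // l ∈ I} → LType} :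
      r₁ ≠ r₂ → (∀ i, Proj (G i) r₁ (T i)) →
      Proj (.comm r₁ r₂ I hI δ S G) r₁ (.sel r₂ I hI δ S T)
  | recv {r₁ r₂ : Role} {I hI δ S} {G : {l // l ∈ I} → GType} {T : {l // l ∈ I} → LType} :
      r₁ ≠ r₂ → (∀ i, Proj (G i) r₂ (T i)) →
      Proj (.comm r₁ r₂ I hI δ S G) r₂ (.bra r₁ I hI S T)
  | other {r₁ r₂ r : Role} {I hI δ S} {G : {l // l ∈ I} → GType} {T : LType} :
      r ≠ r₁ → r ≠ r₂ → (∀ i, Proj (G i) r T) →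
      Proj (.comm r₁ r₂ I hI δ S G) r T
  | mu {G : GType} {r : Role} {T : LType} :
      Proj G r T → T ≠ .fin → ¬ T.Exposed 0 → Proj (.mu G) r (.mu T)
  | muFin {G : GType} {r : Role} : Proj G r .fin → Proj (.mu G) r .fin
  | tvar {t : ℕ} {r : Role} : Proj (.tvar t) r (.tvar t)
  | fin {r : Role} : Proj .fin r .fin

/-- Well-formed global types: closed, guarded, with reachable imprecise probabilities, and with a
defined projection onto each participant. -/
structure GType.WF (G : GType) : Prop where
  closed : G.ClosedAt 0
  guarded : G.Guarded
  reachable : G.AllReachable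
  projectable : ∀ r ∈ G.pid, ∃ T, Proj G r T

/-! ### Processes -/

/-- Values: variables, session names and literals. -/
inductive Val where
  | var (x : ℕ)
  | sess (s : ℕ)
  | bool (b : Bool)
  | nat (n : ℕ)
  | int (z : ℤ)
  | str (w : String)

/-- Channels: a channel variable, or the channel `s[r]` with role `r` of the session `s`. -/
inductive Chan where
  | var (y : ℕ)
  | role (s : ℕ) (r : Role)
  deriving DecidableEq

/-- Processes, with restrictions annotated by global types.
* `sel c r I _ p v P` is the selection `c[r] ⊕ ⟨pᵢ : lᵢ(vᵢ); Pᵢ⟩`;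
* `bra c r I _ P` is the branching `c[r] & {lᵢ(xᵢ); Pᵢ}`, binding value variable `0` in each `Pᵢ`;
* `nu G P` is `(νs : G) P`, binding session name `0` in `P`;
* `defn n m B P` is `def X(x₁…xₙ y₁…yₘ) = B in P`, with value parameters `x` and channel
  parameters `y`: process variable `0` is bound in `B` and `P`, the value variables `0,…,n-1` and
  the channel variables `0,…,m-1` are bound in `B`;
* `call X v c` is the call `X(v₁…vₙ c₁…cₘ)`. -/
inductive Proc where
  | nil
  | par (P Q : Proc)
  | sel (c : Chan) (r : Role) (I : Finset Label) (hI : I.Nonempty) (p : {l // l ∈ I} → ℝ)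
      (v : {l // l ∈ I} → Val) (P : {l // l ∈ I} → Proc)
  | bra (c : Chan) (r : Role) (I : Finset Label) (hI : I.Nonempty) (P : {l // l ∈ I} → Proc)
  | nu (G : GType) (P : Proc)
  | defn (n m : ℕ) (B P : Proc)
  | call (X : ℕ) (v : List Val) (c : List Chan)

/-- Renaming of session names in a value. -/
def Val.ren (f : ℕ → ℕ) : Val → Val
  | sess s => sess (f s)
  | v => v

/-- Shift of the value variables by `k`. -/
def Val.shift (k : ℕ) : Val → Val
  | var x => var (x + k)
  | v => v

/-- Substitution of values for value variables in a value. -/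
def Val.subst (σ : ℕ → Val) : Val → Val
  | var x => σ x
  | v => v

/-- Renaming of session names in a channel. -/
def Chan.ren (f : ℕ → ℕ) : Chan → Chan
  | role s r => role (f s) r
  | c => c

/-- Shift of the channel variables by `k`. -/
def Chan.shift (k : ℕ) : Chan → Chan
  | var y => var (y + k)
  | c => c

/-- Substitution of channels for channel variables in a channel. -/
def Chan.subst (τ : ℕ → Chan) : Chan → Chan
  | var y => τ y
  | c => c

/-- Lifting of a substitution of values under `k` binders. -/
def liftV (k : ℕ) (σ : ℕ → Val) (i : ℕ) : Val :=
  if i < k then .var i else (σ (i - k)).shift k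

/-- Lifting of a substitution of channels under `k` binders. -/
def liftC (k : ℕ) (τ : ℕ → Chan) (i : ℕ) : Chan :=
  if i < k then .var i else (τ (i - k)).shift k

/-- The substitution of the actual parameters `v` for the innermost `v.length` value variables. -/
def instV (v : List Val) (i : ℕ) : Val := v.getD i (.var (i - v.length))

/-- The substitution of the actual parameters `c` for the innermost `c.length` channel variables. -/
def instC (c : List Chan) (i : ℕ) : Chan := c.getD i (.var (i - c.length))

namespace Proc

/-- Capture-avoiding renaming of free session names (by `f`) and free process variables (by `g`). -/
def ren : (ℕ → ℕ) → (ℕ → ℕ) → Proc → Proc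
  | _, _, nil => nil
  | f, g, par P Q => par (P.ren f g) (Q.ren f g)
  | f, g, sel c r I hI p v P =>
      sel (c.ren f) r I hI p (fun i => (v i).ren f) (fun i => (P i).ren f g)
  | f, g, bra c r I hI P => bra (c.ren f) r I hI (fun i => (P i).ren f g)
  | f, g, nu G P => nu G (P.ren (up f) g)
  | f, g, defn n m B P => defn n m (B.ren f (up g)) (P.ren f (up g))
  | f, g, call X v c => call (g X) (v.map (Val.ren f)) (c.map (Chan.ren f))

/-- Renaming of free session names. -/
def renS (f : ℕ → ℕ) (P : Proc) : Proc := P.ren f id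

/-- Renaming of free process variables. -/
def renX (g : ℕ → ℕ) (P : Proc) : Proc := P.ren id g

/-- Capture-avoiding simultaneous substitution of values for the free value variables and of
channels for the free channel variables. -/
def subst : (ℕ → Val) → (ℕ → Chan) → Proc → Proc
  | _, _, nil => nil
  | σ, τ, par P Q => par (P.subst σ τ) (Q.subst σ τ)
  | σ, τ, sel c r I hI p v P =>
      sel (c.subst τ) r I hI p (fun i => (v i).subst σ) (fun i => (P i).subst σ τ)
  | σ, τ, bra c r I hI P => bra (c.subst τ) r I hI (fun i => (P i).subst (liftV 1 σ) τ)
  | σ, τ, nu G P =>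
      nu G (P.subst (fun i => (σ i).ren Nat.succ) (fun i => (τ i).ren Nat.succ))
  | σ, τ, defn n m B P => defn n m (B.subst (liftV n σ) (liftC m τ)) (P.subst σ τ)
  | σ, τ, call X v c => call X (v.map (Val.subst σ)) (c.map (Chan.subst τ))

/-- Parallel composition of a finite family of processes. -/
def parAll {n : ℕ} (P : Fin n → Proc) : Proc := (List.ofFn P).foldr par nil

/-- The process interacts only on the channel `s[r]`: this is the only channel with role that
occurs in it, free or bound, including in continuations and in the bodies of definitions. -/
def OnlyOn : ℕ → Role → Proc → Prop
  | _, _, nil => True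
  | s, r, par P Q => P.OnlyOn s r ∧ Q.OnlyOn s r
  | s, r, sel c _ _ _ _ _ P =>
      (∀ s' r', c = .role s' r' → s' = s ∧ r' = r) ∧ ∀ i, (P i).OnlyOn s r
  | s, r, bra c _ _ _ P =>
      (∀ s' r', c = .role s' r' → s' = s ∧ r' = r) ∧ ∀ i, (P i).OnlyOn s r
  | s, r, nu _ P => P.OnlyOn (s + 1) r
  | s, r, defn _ _ B P => B.OnlyOn s r ∧ P.OnlyOn s r
  | s, r, call _ _ c => ∀ s' r', .role s' r' ∈ c → s' = s ∧ r' = r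

end Proc

/-- Structural congruence. Side conditions that a bound name is not free in a subterm are expressed
by shifting the indices of this subterm. -/
inductive SCong : Proc → Proc → Prop where
  | refl (P) : SCong P P
  | symm {P Q} : SCong P Q → SCong Q P
  | trans {P Q R} : SCong P Q → SCong Q R → SCong P R
  | parComm (P Q) : SCong (.par P Q) (.par Q P)
  | parAssoc (P Q R) : SCong (.par (.par P Q) R) (.par P (.par Q R))
  | parNil (P) : SCong (.par P .nil) P
  | nuNil (G) : SCong (.nu G .nil) .nil
  | nuSwap (G G' P) : SCong (.nu G (.nu G' P)) (.nu G' (.nu G (P.renS swap01)))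
  | nuPar (G P Q) : SCong (.par (.nu G P) Q) (.nu G (.par P (Q.renS Nat.succ)))
  | defNil (n m B) : SCong (.defn n m B .nil) .nil
  | defNu (n m B G P) :
      SCong (.defn n m B (.nu G P)) (.nu G (.defn n m (B.renS Nat.succ) P))
  | defPar (n m B P Q) :
      SCong (.defn n m B (.par P (Q.renX Nat.succ))) (.par (.defn n m B P) Q)
  /- `B` and `B'` are the two bodies without the process variable of the other definition;
  `up Nat.succ` inserts this variable just outside their own one. -/
  | defSwap (n m B n' m' B' P) :
      SCong (.defn n m B (.defn n' m' (B'.renX (up Nat.succ)) P))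
        (.defn n' m' B' (.defn n m (B.renX (up Nat.succ)) (P.renX swap01)))
  | par {P P' Q Q'} : SCong P P' → SCong Q Q' → SCong (.par P Q) (.par P' Q')
  | sel (c r I hI p v) {P P' : _ → Proc} : (∀ i, SCong (P i) (P' i)) →
      SCong (.sel c r I hI p v P) (.sel c r I hI p v P')
  | bra (c r I hI) {P P' : _ → Proc} : (∀ i, SCong (P i) (P' i)) →
      SCong (.bra c r I hI P) (.bra c r I hI P')
  | nu (G) {P P'} : SCong P P' → SCong (.nu G P) (.nu G P')
  | defn (n m) {B B' P P'} : SCong B B' → SCong P P' → SCong (.defn n m B P) (.defn n m B' P')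

/-! ### Operational semantics -/

/-- Number of active (not guarded by a prefix) selections on `s[r₁]` towards `r₂`. -/
def Proc.selCount : ℕ → Role → Role → Proc → ℕ
  | s, r₁, r₂, par P Q => P.selCount s r₁ r₂ + Q.selCount s r₁ r₂
  | s, r₁, r₂, sel c r _ _ _ _ _ => if c = .role s r₁ ∧ r = r₂ then 1 else 0
  | s, r₁, r₂, nu _ P => P.selCount (s + 1) r₁ r₂
  | s, r₁, r₂, defn _ _ _ P => P.selCount s r₁ r₂
  | _, _, _, _ => 0

/-- Number of active branchings on `s[r₂]` from `r₁`. -/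
def Proc.braCount : ℕ → Role → Role → Proc → ℕ
  | s, r₂, r₁, par P Q => P.braCount s r₂ r₁ + Q.braCount s r₂ r₁
  | s, r₂, r₁, bra c r _ _ _ => if c = .role s r₂ ∧ r = r₁ then 1 else 0
  | s, r₂, r₁, nu _ P => P.braCount (s + 1) r₂ r₁
  | s, r₂, r₁, defn _ _ _ P => P.braCount s r₂ r₁
  | _, _, _, _ => 0

/-- Number of active calls of the process variable `X`. -/
def Proc.callCount : ℕ → Proc → ℕ
  | X, par P Q => P.callCount X + Q.callCount X
  | X, call Y _ _ => if Y = X then 1 else 0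
  | X, nu _ P => P.callCount X
  | X, defn _ _ _ P => P.callCount (X + 1)
  | _, _ => 0

/-- Number of disjoint pairs consisting of an active selection and a matching active branching on
the session `s`. -/
noncomputable def Proc.comCount (s : ℕ) (P : Proc) : ℕ :=
  ∑ᶠ q : Role × Role, min (P.selCount s q.1 q.2) (P.braCount s q.2 q.1)

/-- The part of `nextProc` due to the sessions and the process variables bound in the process. -/
noncomputable def Proc.boundCount : Proc → ℕ
  | par P Q => P.boundCount + Q.boundCount
  | nu _ P => P.boundCount + P.comCount 0
  | defn _ _ _ P => P.boundCount + P.callCount 0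
  | _ => 0

/-- The number of communications and calls that are possible in a process. -/
noncomputable def Proc.nextProc (P : Proc) : ℕ := P.boundCount + ∑ᶠ s : ℕ, P.comCount s

/-- Evaluation contexts with one hole. -/
inductive ECtx where
  | hole
  | parL (E : ECtx) (Q : Proc)
  | parR (P : Proc) (E : ECtx)
  | nu (G : GType) (E : ECtx)
  | defn (n m : ℕ) (B : Proc) (E : ECtx)

/-- Filling the hole of an evaluation context. -/
def ECtx.fill : ECtx → Proc → Proc
  | hole, P => P
  | parL E Q, P => .par (E.fill P) Q
  | parR Q E, P => .par Q (E.fill P)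
  | nu G E, P => .nu G (E.fill P)
  | defn n m B E, P => .defn n m B (E.fill P)

/-- Transition labels `(r₁, r₂, l)` and `ε`. -/
inductive TLabel where
  | com (r₁ r₂ : Role) (l : Label)
  | eps

/-- `Step P tl p P'`: the process `P` evolves to `P'` with label `tl` and probability `p`. -/
inductive Step : Proc → TLabel → ℝ → Proc → Prop where
  | com (s : ℕ) (r₁ r₂ : Role) (J I : Finset Label) (hJ hI) (p : {l // l ∈ J} → ℝ)
      (v : {l // l ∈ J} → Val) (P : {l // l ∈ J} → Proc) (P' : {l // l ∈ I} → Proc)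
      (hJI : J ⊆ I) (k : Label) (hk : k ∈ J) :
      Step (.par (.sel (.role s r₁) r₂ J hJ p v P) (.bra (.role s r₂) r₁ I hI P'))
        (.com r₁ r₂ k) (p ⟨k, hk⟩)
        (.par (P ⟨k, hk⟩) ((P' ⟨k, hJI hk⟩).subst (instV [v ⟨k, hk⟩]) Chan.var))
  | call (n m : ℕ) (B Q : Proc) (v : List Val) (c : List Chan)
      (hv : v.length = n) (hc : c.length = m) :
      Step (.defn n m B (.par (.call 0 v c) Q)) .eps 1
        (.defn n m B (.par (B.subst (instV v) (instC c)) Q))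
  | ctxt (E : ECtx) {P P' : Proc} {tl : TLabel} {p : ℝ} : Step P tl p P' →
      Step (E.fill P) tl (p * P.nextProc / (E.fill P).nextProc) (E.fill P')
  | struct {P P' Q Q' : Proc} {tl : TLabel} {p : ℝ} :
      SCong P P' → Step P' tl p Q' → SCong Q Q' → Step P tl p Q

/-- Finite sequences of transitions, with their labels and the product of their probabilities. -/
inductive Steps : Proc → List TLabel → ℝ → Proc → Prop where
  | refl (P) : Steps P [] 1 P
  | head {P P' P'' : Proc} {tl : TLabel} {tls : List TLabel} {p q : ℝ} :
      Step P tl p P' → Steps P' tls q P'' → Steps P (tl :: tls) (p * q) P''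

/-- The process has no transition. -/
def Stuck (P : Proc) : Prop := ∀ tl p P', ¬ Step P tl p P'

/-- Every stuck process reachable from `P` is structurally congruent to inaction. -/
def DeadlockFree (P : Proc) : Prop :=
  ∀ tls p P', Steps P tls p P' → Stuck P' → SCong P' .nil

/-! ### Typing -/

/-- Sorting of values: `Γ` lists the sorts of the value variables. -/
inductive HasSort (Γ : List Srt) : Val → Srt → Prop where
  | var {x : ℕ} {S : Srt} : Γ[x]? = some S → HasSort Γ (.var x) S
  | sess (s) : HasSort Γ (.sess s) .session
  | bool (b) : HasSort Γ (.bool b) .bool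
  | nat (n) : HasSort Γ (.nat n) .nat
  | int (z) : HasSort Γ (.int z) .int
  | str (w) : HasSort Γ (.str w) .string

/-- Typings: partial maps from channels to local types. -/
abbrev Typing := Chan → Option LType

namespace Typing

/-- The empty typing. -/
def empty : Typing := fun _ => none

/-- `Δ, c : T`. -/
def add (Δ : Typing) (c : Chan) (T : LType) : Typing := Function.update Δ c (some T)

/-- The typing contains only `end`. -/
def EndOnly (Δ : Typing) : Prop := ∀ c T, Δ c = some T → T = .fin

/-- `Δ` is the disjoint union of `Δ₁` and `Δ₂`. -/
def Split (Δ Δ₁ Δ₂ : Typing) : Prop :=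
  ∀ c, (Δ₁ c = none ∧ Δ c = Δ₂ c) ∨ (Δ₂ c = none ∧ Δ c = Δ₁ c)

/-- `Δ, {s[r] : T r}` for `r` in `R`, where `s` is a new session name (the new index `0`). -/
def addSession (Δ : Typing) (R : Finset Role) (T : Role → LType) : Typing
  | .var y => Δ (.var y)
  | .role 0 r => if r ∈ R then some (T r) else none
  | .role (s + 1) r => Δ (.role s r)

/-- The typing `y₁ : T₁, …, yₘ : Tₘ` of the channel parameters of a definition. -/
def params (T : List LType) : Typing
  | .var y => T[y]?
  | .role _ _ => none

end Typing

/-- `Typed Γ Ξ P Δ`: the process `P` has typing `Δ`, where the sorting is given by the list `Γ` of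
the sorts of the value variables and the list `Ξ` of the types of the process variables. -/
inductive Typed : List Srt → List (List Srt × List LType) → Proc → Typing → Prop where
  | sel {Γ Ξ} {Δ : Typing} {c : Chan} {r : Role} {I hI δ p v} {S : {l // l ∈ I} → Srt}
      {P : {l // l ∈ I} → Proc} {T : {l // l ∈ I} → LType} :
      Δ c = none → (∀ i, HasSort Γ (v i) (S i)) → (∀ i, Typed Γ Ξ (P i) (Δ.add c (T i))) →
      ∑ i, p i = 1 → (∀ i, (δ i).lo ≤ p i ∧ p i ≤ (δ i).hi) →
      Typed Γ Ξ (.sel c r I hI p v P) (Δ.add c (.sel r I hI δ S T))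
  | bra {Γ Ξ} {Δ : Typing} {c : Chan} {r : Role} {I hI} {S : {l // l ∈ I} → Srt}
      {P : {l // l ∈ I} → Proc} {T : {l // l ∈ I} → LType} :
      Δ c = none → (∀ i, Typed (S i :: Γ) Ξ (P i) (Δ.add c (T i))) →
      Typed Γ Ξ (.bra c r I hI P) (Δ.add c (.bra r I hI S T))
  | nil {Γ Ξ} {Δ : Typing} : Δ.EndOnly → Typed Γ Ξ .nil Δ
  | par {Γ Ξ P Q} {Δ Δ₁ Δ₂ : Typing} : Typed Γ Ξ P Δ₁ → Typed Γ Ξ Q Δ₂ → Δ.Split Δ₁ Δ₂ →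
      Typed Γ Ξ (.par P Q) Δ
  | nu {Γ Ξ P} {G : GType} {T : Role → LType} {Δ : Typing} : G.WF →
      (∀ r ∈ G.pid, Proj G r (T r)) → Typed Γ Ξ P (Δ.addSession G.pid T) →
      Typed Γ Ξ (.nu G P) Δ
  /- The body of a declaration is closed: its only value variables and channels are its
  parameters. -/
  | defn {Γ Ξ n m B P} {S : List Srt} {T : List LType} {Δ : Typing} :
      S.length = n → T.length = m → Typed S ((S, T) :: Ξ) B (Typing.params T) →
      Typed Γ ((S, T) :: Ξ) P Δ → Typed Γ Ξ (.defn n m B P) Δ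
  | call {Γ Ξ X v c} {S : List Srt} {T : List LType} {Δ : Typing} :
      Ξ[X]? = some (S, T) → List.Forall₂ (HasSort Γ) v S →
      c.Nodup → List.Forall₂ (fun a A => Δ a = some A) c T →
      (∀ a, a ∉ c → ∀ A, Δ a = some A → A = .fin) →
      Typed Γ Ξ (.call X v c) Δ
  /- Local types are identified up to unfolding. -/
  | conv {Γ Ξ P c} {Δ : Typing} {T T' : LType} : Typed Γ Ξ P Δ → Δ c = some T → T.Equiv T' →
      Typed Γ Ξ P (Δ.add c T')

end PMST

namespace PMST

/-! ### Infinite unfoldings of local types -/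

/-! A deadlock between sessions needs a process that holds several channels and waits on one of
them. Here each thread holds one channel, so only a session by itself could block, and a session
that follows a global type does not.

The proof replaces typing by an invariant `WT` on infinite trees: equi-recursive equality becomes
equality, and an absent channel is one with the tree of `end`. A restricted session carries trees
for its roles that are only required to be `Coherent`, not to be the projections of its annotation,
and a definition may stay untyped as long as nothing calls it. This freedom makes `WT` stable under
structural congruence (`SCong.wt_iff`), which, read backwards, can create arbitrary restrictions and
definitions around inaction.

Coherence survives interactions (`Coherent.step`). Roles may interact ahead of independent
interactions that come earlier in the global type; the overtaken ones are remembered as a finite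
tree above it. Coherence also gives progress (`Coherent.progress`): a role whose projection is not
`end` acts on every path after boundedly many constructors, so unfolding reaches some interaction,
whose two roles are then ready for each other.

The assumption on the threads turns the unrestricted discipline into the one with a single channel
at each active prefix or call (`WT.inner_of_onlyOn`), which reduction preserves (`Step.preserves`).
In a stuck normal form no call is left, since its definition could be unfolded. If a session were
unfinished, two of its roles would match, and the threads that own them, having nothing else in use,
would be the two prefixes of a communication (`Flat.canStep`). Hence all sessions are finished, no
prefix remains, and the remaining binders collapse. -/

/-- The outermost constructor of an unfolded local type, up to the data that plays no role in
progress. -/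
inductive LNode where
  | sel (r : Role) (I : Finset Label)
  | bra (r : Role) (I : Finset Label)
  | fin
  | other

/-- Infinite trees: the node reached by each sequence of labels. -/
abbrev LTree := List Label → LNode

/-- The tree of `end`. -/
def finT : LTree := fun _ => .fin

/-- The subtree below the label `l`. -/
def child (t : LTree) (l : Label) : LTree := fun p => t (l :: p)

theorem ne_finT_of_sel {t : LTree} {r I} (h : t [] = .sel r I) : t ≠ finT := by
  rintro rfl; simp [finT] at h

theorem ne_finT_of_bra {t : LTree} {r I} (h : t [] = .bra r I) : t ≠ finT := by
  rintro rfl; simp [finT] at h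

namespace LType

theorem HeadsTo.unique {T U V : LType} (h : HeadsTo T U) (h' : HeadsTo T V) : U = V := by
  induction h with
  | sel => cases h'; rfl
  | bra => cases h'; rfl
  | tvar => cases h'; rfl
  | fin => cases h'; rfl
  | mu _ ih => cases h' with | mu h' => exact ih h'

open Classical in
/-- The unfolding of the recursions at the top of a type; a variable if there is none. -/
noncomputable def head (T : LType) : LType :=
  if h : ∃ U, HeadsTo T U then h.choose else .tvar 0

theorem HeadsTo.head_eq {T U : LType} (h : HeadsTo T U) : T.head = U := by
  have hex : ∃ U, HeadsTo T U := ⟨U, h⟩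
  rw [head, dif_pos hex]
  exact hex.choose_spec.unique h

/-- If the unfolding never reaches a head, both sides take the same default value, so guardedness is
not needed. -/
theorem head_mu (T : LType) : (mu T).head = (T.inst (mu T)).head := by
  by_cases h : ∃ U, HeadsTo (T.inst (mu T)) U
  · obtain ⟨U, h⟩ := h
    rw [h.head_eq, (HeadsTo.mu h).head_eq]
  · have h' : ¬ ∃ U, HeadsTo (mu T) U := by
      rintro ⟨U, hU⟩
      cases hU with | mu hU => exact h ⟨U, hU⟩
    rw [head, head, dif_neg h, dif_neg h']

/-- The outermost constructor of a type. -/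
def node : LType → LNode
  | sel r I _ _ _ _ => .sel r I
  | bra r I _ _ _ => .bra r I
  | fin => .fin
  | _ => .other

/-- The continuation of a type after the label `l`. -/
def cont (l : Label) : LType → LType
  | sel _ I _ _ _ T => if h : l ∈ I then T ⟨l, h⟩ else .fin
  | bra _ I _ _ T => if h : l ∈ I then T ⟨l, h⟩ else .fin
  | _ => .fin

/-- The infinite unfolding of a local type. -/
noncomputable def tree (T : LType) : LTree
  | [] => T.head.node
  | l :: p => (T.head.cont l).tree p

theorem tree_congr_head {T T' : LType} (h : T.head = T'.head) : T.tree = T'.tree := by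
  funext p
  cases p <;> simp [tree, h]

theorem tree_mu (T : LType) : (mu T).tree = (T.inst (mu T)).tree := tree_congr_head (head_mu T)

theorem tree_fin : LType.fin.tree = finT := by
  funext p
  induction p with
  | nil => simp [tree, HeadsTo.fin.head_eq, node, finT]
  | cons l p ih => simpa [tree, HeadsTo.fin.head_eq, cont, finT] using ih

theorem tree_sel_nil {r I hI δ S T} : (sel r I hI δ S T).tree [] = .sel r I := by
  simp [tree, (HeadsTo.sel r I hI δ S T).head_eq, node]

theorem tree_bra_nil {r I hI S T} : (bra r I hI S T).tree [] = .bra r I := by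
  simp [tree, (HeadsTo.bra r I hI S T).head_eq, node]

theorem child_tree_sel {r I hI δ S T} (i : {l // l ∈ I}) :
    child (sel r I hI δ S T).tree i = (T i).tree := by
  funext p
  simp [child, tree, (HeadsTo.sel r I hI δ S T).head_eq, cont]

theorem child_tree_bra {r I hI S T} (i : {l // l ∈ I}) :
    child (bra r I hI S T).tree i = (T i).tree := by
  funext p
  simp [child, tree, (HeadsTo.bra r I hI S T).head_eq, cont]

/-- Following a path stays inside the bisimulation, so the nodes at its end agree. -/
theorem Equiv.tree_eq {T T' : LType} (h : T.Equiv T') : T.tree = T'.tree := by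
  obtain ⟨R, hR, hb⟩ := h
  funext p
  induction p generalizing T T' with
  | nil =>
    obtain ⟨A, B, hA, hB, hs⟩ := hb _ _ hR
    rw [tree, tree, hA.head_eq, hB.head_eq]
    cases hs <;> rfl
  | cons l p ih =>
    obtain ⟨A, B, hA, hB, hs⟩ := hb _ _ hR
    rw [tree, tree, hA.head_eq, hB.head_eq]
    cases hs with
    | sel r I hI δ S h =>
      by_cases hl : l ∈ I
      · simpa [cont, hl] using ih (h ⟨l, hl⟩)
      · simp [cont, hl]
    | bra r I hI S h =>
      by_cases hl : l ∈ I
      · simpa [cont, hl] using ih (h ⟨l, hl⟩)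
      · simp [cont, hl]
    | tvar => rfl
    | fin => rfl

theorem Exposed.of_ren {T : LType} {f : ℕ → ℕ} {k : ℕ} (h : (T.ren f).Exposed k) :
    ∃ j, f j = k ∧ T.Exposed j := by
  induction T generalizing f k with
  | sel => exact h.elim
  | bra => exact h.elim
  | fin => exact h.elim
  | tvar t => exact ⟨t, h, rfl⟩
  | mu T ih =>
    obtain ⟨j, hj, hT⟩ := ih h
    cases j with
    | zero => simp [up] at hj
    | succ j => exact ⟨j, by simpa [up] using hj, hT⟩

/-- Substitution under a binder shifts the substituted types, so the bound variable is exposed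
afterwards only if it was before. This keeps projected recursions guarded. -/
theorem Exposed.of_subst {T : LType} {σ : ℕ → LType} {k : ℕ} (h : (T.subst σ).Exposed k) :
    ∃ j, T.Exposed j ∧ (σ j).Exposed k := by
  induction T generalizing σ k with
  | sel => exact h.elim
  | bra => exact h.elim
  | fin => exact h.elim
  | tvar t => exact ⟨t, rfl, h⟩
  | mu T ih =>
    obtain ⟨j, hT, hj⟩ := ih h
    cases j with
    | zero => simp [upSubst, Exposed] at hj
    | succ j =>
      obtain ⟨i, hi, hs⟩ := Exposed.of_ren hj
      obtain rfl : i = k := by simpa using hi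
      exact ⟨j, hT, hs⟩

theorem ren_ne_fin {T : LType} {f : ℕ → ℕ} (h : T ≠ fin) : T.ren f ≠ fin := by
  cases T <;> simp_all [ren]

theorem subst_ne_fin {T : LType} {σ : ℕ → LType} (hσ : ∀ t, σ t ≠ fin) (h : T ≠ fin) :
    T.subst σ ≠ fin := by
  cases T <;> simp_all [subst]

end LType

/-! ### Unfolding of global types -/

namespace GType

/-- Renaming of type variables. -/
def ren : (ℕ → ℕ) → GType → GType
  | f, comm r₁ r₂ I hI δ S G => comm r₁ r₂ I hI δ S (fun i => (G i).ren f)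
  | f, mu G => mu (G.ren (up f))
  | f, tvar t => tvar (f t)
  | _, fin => fin

/-- Lifting of a substitution under one recursion binder. -/
def upSubst (γ : ℕ → GType) : ℕ → GType
  | 0 => tvar 0
  | n + 1 => (γ n).ren Nat.succ

/-- Capture-avoiding simultaneous substitution for type variables. -/
def subst : (ℕ → GType) → GType → GType
  | γ, comm r₁ r₂ I hI δ S G => comm r₁ r₂ I hI δ S (fun i => (G i).subst γ)
  | γ, mu G => mu (G.subst (upSubst γ))
  | γ, tvar t => γ t
  | _, fin => fin

/-- `G.inst H` is `G{H/t}`, where `t` is the type variable of index `0`. -/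
def inst (G H : GType) : GType :=
  G.subst (fun n => match n with
    | 0 => H
    | k + 1 => tvar k)

theorem pid_ren (G : GType) (f : ℕ → ℕ) : (G.ren f).pid = G.pid := by
  induction G generalizing f with
  | comm r₁ r₂ I hI δ S G ih => simp [ren, pid, ih]
  | mu G ih => simp [ren, pid, ih]
  | tvar t => rfl
  | fin => rfl

theorem mem_pid_subst {G : GType} {γ : ℕ → GType} {r : Role} (h : r ∈ (G.subst γ).pid) :
    r ∈ G.pid ∨ ∃ t, r ∈ (γ t).pid := by
  induction G generalizing γ with
  | comm r₁ r₂ I hI δ S G ih =>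
    simp only [subst, pid, Finset.mem_union, Finset.mem_biUnion, Finset.mem_univ, true_and] at h ⊢
    rcases h with h | ⟨i, h⟩
    · exact Or.inl (Or.inl h)
    · rcases ih i h with h | h
      · exact Or.inl (Or.inr ⟨i, h⟩)
      · exact Or.inr h
  | mu G ih =>
    rcases ih h with h | ⟨t, h⟩
    · exact Or.inl h
    · cases t with
      | zero => simp [upSubst, pid] at h
      | succ t => exact Or.inr ⟨t, by simpa [upSubst, pid_ren] using h⟩
  | tvar t => exact Or.inr ⟨t, h⟩
  | fin => simp [subst, pid] at h

theorem pid_inst_mu {G : GType} {r : Role} (h : r ∈ (G.inst (mu G)).pid) : r ∈ G.pid := by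
  rcases mem_pid_subst h with h | ⟨t, h⟩
  · exact h
  · cases t with
    | zero => exact h
    | succ t => simp [pid] at h

theorem ClosedAt.ren {G : GType} {k m : ℕ} {f : ℕ → ℕ} (h : G.ClosedAt k)
    (hf : ∀ t < k, f t < m) : (G.ren f).ClosedAt m := by
  induction G generalizing k m f with
  | comm r₁ r₂ I hI δ S G ih => exact fun i => ih i (h i) hf
  | mu G ih =>
    refine ih (k := k + 1) h ?_
    rintro (_ | t) ht
    · simp [up]
    · have := hf t (by omega)
      simp only [up]; omega
  | tvar t => exact hf t h
  | fin => trivial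

theorem ClosedAt.subst {G : GType} {k m : ℕ} {γ : ℕ → GType} (h : G.ClosedAt k)
    (hγ : ∀ t < k, (γ t).ClosedAt m) : (G.subst γ).ClosedAt m := by
  induction G generalizing k m γ with
  | comm r₁ r₂ I hI δ S G ih => exact fun i => ih i (h i) hγ
  | mu G ih =>
    refine ih (k := k + 1) h ?_
    rintro (_ | t) ht
    · simp [upSubst, ClosedAt]
    · exact (hγ t (by omega)).ren (fun t ht => by omega)
  | tvar t => exact hγ t h
  | fin => trivial

theorem ClosedAt.inst_mu {G : GType} (h : (mu G).ClosedAt 0) : (G.inst (mu G)).ClosedAt 0 := by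
  refine ClosedAt.subst (k := 1) h ?_
  rintro (_ | t) ht
  · exact h
  · omega

/-- On each path, the role `r` takes part in an interaction before any variable or `end`, and
after fewer than `n` constructors. -/
def Hits (r : Role) : ℕ → GType → Prop
  | n + 1, comm r₁ r₂ _ _ _ _ G => r = r₁ ∨ r = r₂ ∨ ∀ i, (G i).Hits r n
  | n + 1, mu G => G.Hits r n
  | _, _ => False

theorem Hits.mono {r : Role} {G : GType} {n m : ℕ} (h : G.Hits r n) (hnm : n ≤ m) :
    G.Hits r m := by
  induction n generalizing m G with
  | zero => cases G <;> exact h.elim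
  | succ n ih =>
    obtain ⟨m, rfl⟩ : ∃ k, m = k + 1 := ⟨m - 1, by omega⟩
    cases G with
    | comm r₁ r₂ I hI δ S G =>
      rcases h with h | h | h
      · exact Or.inl h
      · exact Or.inr (Or.inl h)
      · exact Or.inr (Or.inr fun i => ih (h i) (by omega))
    | mu G => exact ih (G := G) h (by omega)
    | tvar t => exact h.elim
    | fin => exact h.elim

/-- The role acts before any variable is met, so the substituted types are out of reach. The bound
stays while the type may grow, which makes it a measure for inductions that unfold recursions. -/
theorem Hits.subst {r : Role} {G : GType} {n : ℕ} {γ : ℕ → GType} (h : G.Hits r n) :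
    (G.subst γ).Hits r n := by
  induction n generalizing G γ with
  | zero => cases G <;> exact h.elim
  | succ n ih =>
    cases G with
    | comm r₁ r₂ I hI δ S G =>
      rcases h with h | h | h
      · exact Or.inl h
      · exact Or.inr (Or.inl h)
      · exact Or.inr (Or.inr fun i => ih (h i))
    | mu G => exact ih (G := G) h
    | tvar t => exact h.elim
    | fin => exact h.elim

end GType

theorem Proj.ren {G : GType} {r : Role} {T : LType} (h : Proj G r T) (f : ℕ → ℕ) :
    Proj (G.ren f) r (T.ren f) := by
  induction h generalizing f with
  | send hne _ ih => exact .send hne fun i => ih i f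
  | recv hne _ ih => exact .recv hne fun i => ih i f
  | other h₁ h₂ _ ih => exact .other h₁ h₂ fun i => ih i f
  | mu _ hT hE ih =>
    refine .mu (ih _) (LType.ren_ne_fin hT) fun h => ?_
    obtain ⟨j, hj, h⟩ := LType.Exposed.of_ren h
    cases j with
    | zero => exact hE h
    | succ j => simp [up] at hj
  | muFin _ ih => exact .muFin (ih _)
  | tvar => exact .tvar
  | fin => exact .fin

/-- A variable projects to a variable, never to `end`; so a type that projects to `end` contains no
variable, and nothing is asked of `γ`. -/
theorem Proj.subst_fin {G : GType} {r : Role} {T : LType} (h : Proj G r T) (hT : T = .fin)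
    (γ : ℕ → GType) : Proj (G.subst γ) r .fin := by
  induction h generalizing γ with
  | send => cases hT
  | recv => cases hT
  | other h₁ h₂ _ ih => exact .other h₁ h₂ fun i => ih i hT γ
  | mu => cases hT
  | muFin _ ih => exact .muFin (ih rfl _)
  | tvar => cases hT
  | fin => exact .fin

/-- If some `σ t` were `end`, the body of a recursion could become `end`, and the other clause of
projection would apply. -/
theorem Proj.subst {G : GType} {r : Role} {T : LType} (h : Proj G r T) {γ : ℕ → GType}
    {σ : ℕ → LType} (hp : ∀ t, Proj (γ t) r (σ t)) (hσ : ∀ t, σ t ≠ .fin) :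
    Proj (G.subst γ) r (T.subst σ) := by
  induction h generalizing γ σ with
  | send hne _ ih => exact .send hne fun i => ih i hp hσ
  | recv hne _ ih => exact .recv hne fun i => ih i hp hσ
  | other h₁ h₂ _ ih => exact .other h₁ h₂ fun i => ih i hp hσ
  | mu _ hT hE ih =>
    have hσ' : ∀ t, LType.upSubst σ t ≠ .fin := by
      rintro (_ | t)
      · simp [LType.upSubst]
      · exact LType.ren_ne_fin (hσ t)
    refine .mu (ih ?_ hσ') (LType.subst_ne_fin hσ' hT) fun h => ?_
    · rintro (_ | t)
      · exact .tvar
      · exact (hp t).ren _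
    · obtain ⟨j, hj, h⟩ := LType.Exposed.of_subst h
      cases j with
      | zero => exact hE hj
      | succ j =>
        obtain ⟨i, hi, -⟩ := LType.Exposed.of_ren h
        simp at hi
  | muFin h _ => exact .muFin (h.subst_fin rfl _)
  | tvar => exact hp _
  | fin => exact .fin

theorem Proj.exposed_lt {G : GType} {r : Role} {T : LType} (h : Proj G r T) {j k : ℕ}
    (hG : G.ClosedAt k) (hT : T.Exposed j) : j < k := by
  induction h generalizing j k with
  | send => exact hT.elim
  | recv => exact hT.elim
  | @other _ _ _ I hI _ _ _ _ _ _ _ ih =>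
    obtain ⟨l, hl⟩ := hI
    exact ih ⟨l, hl⟩ (hG _) hT
  | mu _ _ _ ih => exact Nat.lt_of_succ_lt_succ (ih (k := k + 1) hG hT)
  | muFin => exact hT.elim
  | tvar => cases hT; exact hG
  | fin => exact hT.elim

/-- Where `r` does not take part, all branches have the same projection, which is not `end`; so no
branch can leave `r` out. Label sets are finite, so the bounds for the branches have a maximum. -/
theorem Proj.hits {G : GType} {r : Role} {T : LType} (h : Proj G r T) (hT : T ≠ .fin)
    (hE : ∀ k, ¬ T.Exposed k) : ∃ n, G.Hits r n := by
  induction h with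
  | send => exact ⟨1, Or.inl rfl⟩
  | recv => exact ⟨1, Or.inr (Or.inl rfl)⟩
  | @other _ _ _ I _ _ _ _ _ _ _ _ ih =>
    choose n hn using fun i => ih i hT hE
    exact ⟨Finset.univ.sup n + 1, Or.inr (Or.inr fun i =>
      (hn i).mono (Finset.le_sup (f := n) (Finset.mem_univ i)))⟩
  | mu _ hT' hE' ih =>
    -- Variable `0` is excluded by the guardedness built into projection; the others would be
    -- exposed in the recursion itself.
    obtain ⟨n, hn⟩ := ih hT' (by
      rintro (_ | k)
      · exact hE'
      · exact hE k)
    exact ⟨n + 1, hn⟩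
  | muFin => exact absurd rfl hT
  | tvar => exact absurd rfl (hE _)
  | fin => exact absurd rfl hT

/-! ### Coherent sessions -/

/-- The types of the roles of a session after `r₁` has sent the label `l` to `r₂`. -/
def commUpd (U : Role → LTree) (r₁ r₂ : Role) (l : Label) : Role → LTree :=
  Function.update (Function.update U r₁ (child (U r₁) l)) r₂ (child (U r₂) l)

/-- The roles `r₁` and `r₂` are ready to interact on the labels in `I`. -/
structure Matched (U : Role → LTree) (r₁ r₂ : Role) (I : Finset Label) : Prop where
  nonempty : I.Nonempty
  sel : U r₁ [] = .sel r₂ I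
  bra : U r₂ [] = .bra r₁ I

/-- `U` assigns to each role its projection of `G`. -/
def Rep (G : GType) (U : Role → LTree) : Prop :=
  G.ClosedAt 0 ∧ ∀ r, (∃ T, Proj G r T ∧ U r = T.tree) ∨ (r ∉ G.pid ∧ U r = finT)

/-- Projection commutes with unfolding, and trees do not see unfolding. -/
theorem Rep.unfold {G : GType} {U : Role → LTree} (h : Rep (.mu G) U) :
    Rep (G.inst (.mu G)) U := by
  refine ⟨h.1.inst_mu, fun r => ?_⟩
  rcases h.2 r with ⟨T, hT, hU⟩ | ⟨hr, hU⟩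
  · left
    have hT' := hT
    cases hT with
    | @mu _ _ T hp hne hE =>
      refine ⟨T.inst (.mu T), hp.subst ?_ ?_, by rw [hU, LType.tree_mu]⟩
      · rintro (_ | t)
        · exact hT'
        · exact .tvar
      · rintro (_ | t) <;> simp
    | muFin hp => exact ⟨_, hp.subst_fin rfl _, hU⟩
  · exact Or.inr ⟨fun h => hr (GType.pid_inst_mu (G := G) h), hU⟩

/-- A role outside the interaction has the same projection on all branches, so its tree fits every
continuation unchanged. -/
theorem Rep.comm {r₁ r₂ : Role} {I hI δ S G} {U : Role → LTree}
    (h : Rep (.comm r₁ r₂ I hI δ S G) U) :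
    Matched U r₁ r₂ I ∧ ∀ i, Rep (G i) (commUpd U r₁ r₂ i) := by
  have h₁ : ∃ T, r₁ ≠ r₂ ∧ (∀ i, Proj (G i) r₁ (T i)) ∧ U r₁ = (LType.sel r₂ I hI δ S T).tree := by
    rcases h.2 r₁ with ⟨T, hT, hU⟩ | ⟨hr, -⟩
    · cases hT with
      | send hne hp => exact ⟨_, hne, hp, hU⟩
      | recv hne _ => exact absurd rfl hne
      | other h₁ _ _ => exact absurd rfl h₁
    · exact absurd (by simp [GType.pid]) hr
  have h₂ : ∃ T, (∀ i, Proj (G i) r₂ (T i)) ∧ U r₂ = (LType.bra r₁ I hI S T).tree := by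
    rcases h.2 r₂ with ⟨T, hT, hU⟩ | ⟨hr, -⟩
    · cases hT with
      | send hne _ => exact absurd rfl hne
      | recv hne hp => exact ⟨_, hp, hU⟩
      | other _ h₂ _ => exact absurd rfl h₂
    · exact absurd (by simp [GType.pid]) hr
  obtain ⟨T₁, hne, hp₁, hU₁⟩ := h₁
  obtain ⟨T₂, hp₂, hU₂⟩ := h₂
  refine ⟨⟨hI, by rw [hU₁, LType.tree_sel_nil], by rw [hU₂, LType.tree_bra_nil]⟩, fun i => ?_⟩
  refine ⟨h.1 i, fun r => ?_⟩
  by_cases hr₂ : r = r₂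
  · subst hr₂
    exact Or.inl ⟨T₂ i, hp₂ i, by simp [commUpd, hU₂, LType.child_tree_bra]⟩
  by_cases hr₁ : r = r₁
  · subst hr₁
    exact Or.inl ⟨T₁ i, hp₁ i, by simp [commUpd, hr₂, hU₁, LType.child_tree_sel]⟩
  have hU : commUpd U r₁ r₂ i r = U r := by simp [commUpd, hr₁, hr₂]
  rw [hU]
  rcases h.2 r with ⟨T, hT, hU⟩ | ⟨hr, hU⟩
  · cases hT with
    | send => exact absurd rfl hr₁
    | recv => exact absurd rfl hr₂
    | other _ _ hp => exact Or.inl ⟨T, hp i, hU⟩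
  · refine Or.inr ⟨fun hm => hr ?_, hU⟩
    simp only [GType.pid, Finset.mem_union, Finset.mem_biUnion, Finset.mem_univ, true_and]
    exact Or.inr ⟨i, hm⟩

theorem Rep.hits {G : GType} {U : Role → LTree} (h : Rep G U) {r : Role} (hr : U r ≠ finT) :
    ∃ n, G.Hits r n := by
  rcases h.2 r with ⟨T, hT, hU⟩ | ⟨-, hU⟩
  · refine hT.hits ?_ fun k hk => absurd (hT.exposed_lt h.1 hk) (Nat.not_lt_zero k)
    rintro rfl
    exact hr (hU.trans LType.tree_fin)
  · exact absurd hU hr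

/-- Coherent sessions: a finite tree of pending interactions, with the projections of closed global
types at the leaves. -/
inductive Coherent : (Role → LTree) → Prop where
  | base {G U} : Rep G U → Coherent U
  | node {U r₁ r₂ I} : Matched U r₁ r₂ I → (∀ l ∈ I, Coherent (commUpd U r₁ r₂ l)) → Coherent U

theorem Coherent.of_fin {U : Role → LTree} (h : ∀ r, U r = finT) : Coherent U :=
  .base (G := .fin) ⟨trivial, fun r => Or.inr ⟨by simp [GType.pid], h r⟩⟩

/-- The first interaction met will do, whether or not `r` takes part in it; `Hits` only bounds the
number of unfoldings before it. -/
theorem Rep.exists_matched {G : GType} {U : Role → LTree} {r : Role} {n : ℕ} (h : Rep G U)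
    (hn : G.Hits r n) : ∃ r₁ r₂ I, Matched U r₁ r₂ I := by
  induction n generalizing G with
  | zero => cases G <;> exact hn.elim
  | succ n ih =>
    cases G with
    | comm r₁ r₂ I hI δ S G => exact ⟨_, _, _, h.comm.1⟩
    | mu G => exact ih h.unfold (GType.Hits.subst (G := G) hn)
    | tvar t => exact hn.elim
    | fin => exact hn.elim

theorem Coherent.progress {U : Role → LTree} (h : Coherent U) :
    (∀ r, U r = finT) ∨ ∃ r₁ r₂ I, Matched U r₁ r₂ I := by
  cases h with
  | base h =>
    by_cases hU : ∀ r, U r = finT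
    · exact Or.inl hU
    · push Not at hU
      obtain ⟨r, hr⟩ := hU
      obtain ⟨n, hn⟩ := h.hits hr
      exact Or.inr (h.exists_matched hn)
  | node h _ => exact Or.inr ⟨_, _, _, h⟩

/-! ### Interactions that overtake independent ones. -/

theorem commUpd_of_ne {U : Role → LTree} {r₁ r₂ r : Role} {l : Label} (h₁ : r ≠ r₁)
    (h₂ : r ≠ r₂) : commUpd U r₁ r₂ l r = U r := by
  simp [commUpd, h₁, h₂]

theorem commUpd_comm {U : Role → LTree} {r₁ r₂ r₃ r₄ : Role} {l l' : Label} (h₃₁ : r₃ ≠ r₁)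
    (h₃₂ : r₃ ≠ r₂) (h₄₁ : r₄ ≠ r₁) (h₄₂ : r₄ ≠ r₂) :
    commUpd (commUpd U r₁ r₂ l) r₃ r₄ l' = commUpd (commUpd U r₃ r₄ l') r₁ r₂ l := by
  funext r
  simp only [commUpd, Function.update_apply]
  split_ifs <;> simp_all

/-- An interaction that is enabled together with a matched pair either is that of the pair or can
be carried out after it. -/
theorem Matched.coherent_commUpd {U : Role → LTree} {r₁ r₂ r₃ r₄ : Role} {I J J' : Finset Label}
    (h : Matched U r₁ r₂ I) (h₃ : U r₃ [] = .sel r₄ J) (h₄ : U r₄ [] = .bra r₃ J')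
    (here : r₃ = r₁ → ∀ l ∈ I, Coherent (commUpd U r₁ r₂ l))
    (later : r₃ ≠ r₁ → r₃ ≠ r₂ → ∀ l ∈ I, commUpd U r₁ r₂ l r₃ [] = .sel r₄ J →
      commUpd U r₁ r₂ l r₄ [] = .bra r₃ J' →
      J = J' ∧ ∀ l' ∈ J, Coherent (commUpd (commUpd U r₁ r₂ l) r₃ r₄ l')) :
    J = J' ∧ ∀ l ∈ J, Coherent (commUpd U r₃ r₄ l) := by
  by_cases h₃₁ : r₃ = r₁
  · subst h₃₁
    have e := h₃.symm.trans h.sel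
    simp only [LNode.sel.injEq] at e
    obtain ⟨rfl, rfl⟩ := e
    have e := h₄.symm.trans h.bra
    simp only [LNode.bra.injEq] at e
    exact ⟨e.2.symm, here rfl⟩
  have h₃₂ : r₃ ≠ r₂ := by
    rintro rfl
    simp [h.bra] at h₃
  have h₄₁ : r₄ ≠ r₁ := by
    rintro rfl
    simp [h.sel] at h₄
  have h₄₂ : r₄ ≠ r₂ := by
    rintro rfl
    have e := h₄.symm.trans h.bra
    simp only [LNode.bra.injEq] at e
    exact h₃₁ e.1
  have key := fun l hl => later h₃₁ h₃₂ l hl (by rwa [commUpd_of_ne h₃₁ h₃₂])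
    (by rwa [commUpd_of_ne h₄₁ h₄₂])
  -- The equality of label sets does not involve the label of the pair, so one label suffices.
  obtain ⟨l₀, hl₀⟩ := h.nonempty
  refine ⟨(key l₀ hl₀).1, fun l hl => ?_⟩
  -- The overtaken pair becomes the root: its trees are untouched, and the two updates commute.
  refine .node (r₁ := r₁) (r₂ := r₂) (I := I) ⟨h.nonempty, ?_, ?_⟩ fun l' hl' => ?_
  · rw [commUpd_of_ne (Ne.symm h₃₁) (Ne.symm h₄₁), h.sel]
  · rw [commUpd_of_ne (Ne.symm h₃₂) (Ne.symm h₄₂), h.bra]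
  · rw [← commUpd_comm h₃₁ h₃₂ h₄₁ h₄₂]
    exact (key l' hl').2 l hl

/-- The sender acts on every path after boundedly many constructors; the interactions before that
are independent of the pair and are overtaken. -/
theorem Rep.coherent_commUpd {G : GType} {U : Role → LTree} {r₃ r₄ : Role} {J J' : Finset Label}
    {n : ℕ} (h : Rep G U) (hn : G.Hits r₃ n) (h₃ : U r₃ [] = .sel r₄ J)
    (h₄ : U r₄ [] = .bra r₃ J') : J = J' ∧ ∀ l ∈ J, Coherent (commUpd U r₃ r₄ l) := by
  induction n generalizing G U with
  | zero => cases G <;> exact hn.elim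
  | succ n ih =>
    cases G with
    | comm r₁ r₂ I hI δ S G =>
      obtain ⟨hm, hr⟩ := h.comm
      refine hm.coherent_commUpd h₃ h₄ (fun _ l hl => .base (hr ⟨l, hl⟩)) ?_
      intro h₃₁ h₃₂ l hl h₃' h₄'
      rcases hn with hn | hn | hn
      · exact absurd hn h₃₁
      · exact absurd hn h₃₂
      · exact ih (hr ⟨l, hl⟩) (hn _) h₃' h₄'
    | mu G => exact ih h.unfold (GType.Hits.subst (G := G) hn) h₃ h₄
    | tvar t => exact hn.elim
    | fin => exact hn.elim

theorem Coherent.step {U : Role → LTree} (h : Coherent U) {r₃ r₄ : Role} {J J' : Finset Label}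
    (h₃ : U r₃ [] = .sel r₄ J) (h₄ : U r₄ [] = .bra r₃ J') :
    J = J' ∧ ∀ l ∈ J, Coherent (commUpd U r₃ r₄ l) := by
  induction h with
  | base h =>
    obtain ⟨n, hn⟩ := h.hits (ne_finT_of_sel h₃)
    exact h.coherent_commUpd hn h₃ h₄
  | node hm hc ih =>
    exact hm.coherent_commUpd h₃ h₄ (fun _ => hc) fun _ _ l hl h₃' h₄' => ih l hl h₃' h₄'

theorem GType.WF.coherent {G : GType} (hG : G.WF) {T : Role → LType}
    (hT : ∀ r ∈ G.pid, Proj G r (T r)) :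
    Coherent (fun r => if r ∈ G.pid then (T r).tree else finT) := by
  refine .base ⟨hG.closed, fun r => ?_⟩
  by_cases hr : r ∈ G.pid
  · exact Or.inl ⟨T r, hT r hr, by simp [hr]⟩
  · exact Or.inr ⟨hr, by simp [hr]⟩


/-! ### Typings by trees -/

/-- Typings by trees; a channel that is not in use has the tree of `end`. -/
abbrev Typ := Chan → LTree

/-- The typing of the parameters of a definition. -/
def paramTyp (T : List LTree) : Typ
  | .var y => T.getD y finT
  | .role _ _ => finT

/-- Extension of a typing by a new session. -/
def addSess (Δ : Typ) (U : Role → LTree) : Typ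
  | .var y => Δ (.var y)
  | .role 0 r => U r
  | .role (s + 1) r => Δ (.role s r)

/-- `Δ` is the disjoint union of `Δ₁` and `Δ₂`. -/
def Disj (Δ Δ₁ Δ₂ : Typ) : Prop :=
  ∀ c, (Δ₁ c = finT ∧ Δ c = Δ₂ c) ∨ (Δ₂ c = finT ∧ Δ c = Δ₁ c)

/-- At most one channel is in use. -/
def Single (Δ : Typ) : Prop := ∀ c c', Δ c ≠ finT → Δ c' ≠ finT → c = c'

/-- `φ` is a bijection between the channels in use in `Δ` and those in use in `Δ'`, and it
preserves types. -/
structure Carry (φ : Chan → Chan) (Δ Δ' : Typ) : Prop where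
  map : ∀ c, Δ c ≠ finT → Δ' (φ c) = Δ c
  surj : ∀ a, Δ' a ≠ finT → ∃ c, Δ c ≠ finT ∧ φ c = a
  inj : ∀ c c', Δ c ≠ finT → Δ c' ≠ finT → φ c = φ c' → c = c'

/-- All channels in use in `Δ` are in the range of the renaming `f`. -/
def InRange (f : ℕ → ℕ) (Δ : Typ) : Prop := ∀ a, Δ a ≠ finT → ∃ c : Chan, c.ren f = a

theorem Disj.symm {Δ Δ₁ Δ₂ : Typ} (h : Disj Δ Δ₁ Δ₂) : Disj Δ Δ₂ Δ₁ := fun c => (h c).symm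

theorem Disj.left {Δ Δ₁ Δ₂ : Typ} (h : Disj Δ Δ₁ Δ₂) {c : Chan} (hc : Δ₁ c ≠ finT) :
    Δ c = Δ₁ c ∧ Δ₂ c = finT := by
  rcases h c with h | h
  · exact absurd h.1 hc
  · exact ⟨h.2, h.1⟩

theorem Disj.right {Δ Δ₁ Δ₂ : Typ} (h : Disj Δ Δ₁ Δ₂) {c : Chan} (hc : Δ₂ c ≠ finT) :
    Δ c = Δ₂ c ∧ Δ₁ c = finT := h.symm.left hc

theorem Disj.eq_of_left {Δ Δ₁ Δ₂ : Typ} (h : Disj Δ Δ₁ Δ₂) {c : Chan} (hc : Δ₁ c = finT) :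
    Δ c = Δ₂ c := by
  rcases h c with h | h
  · exact h.2
  · rw [h.2, h.1, hc]

theorem Disj.eq_of_right {Δ Δ₁ Δ₂ : Typ} (h : Disj Δ Δ₁ Δ₂) {c : Chan} (hc : Δ₂ c = finT) :
    Δ c = Δ₁ c := h.symm.eq_of_left hc

theorem Disj.exists_ne {Δ Δ₁ Δ₂ : Typ} (h : Disj Δ Δ₁ Δ₂) {c : Chan} (hc : Δ c ≠ finT) :
    Δ₁ c ≠ finT ∨ Δ₂ c ≠ finT := by
  rcases h c with h | h
  · exact Or.inr (h.2 ▸ hc)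
  · exact Or.inl (h.2 ▸ hc)

theorem Disj.single_left {Δ Δ₁ Δ₂ : Typ} (h : Disj Δ Δ₁ Δ₂) (hs : Single Δ) : Single Δ₁ :=
  fun c c' hc hc' => hs c c' ((h.left hc).1 ▸ hc) ((h.left hc').1 ▸ hc')

theorem Disj.fin_right (Δ : Typ) : Disj Δ Δ (fun _ => finT) := fun _ => Or.inr ⟨rfl, rfl⟩

theorem Disj.eq_of_fin {Δ Δ₁ Δ₂ : Typ} (h : Disj Δ Δ₁ Δ₂) (h₂ : ∀ c, Δ₂ c = finT) : Δ = Δ₁ :=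
  funext fun c => h.eq_of_right (h₂ c)

theorem Disj.assoc {Δ Δ₁₂ Δ₁ Δ₂ Δ₃ : Typ} (h : Disj Δ Δ₁₂ Δ₃) (h' : Disj Δ₁₂ Δ₁ Δ₂) :
    ∃ Δ₂₃, Disj Δ Δ₁ Δ₂₃ ∧ Disj Δ₂₃ Δ₂ Δ₃ := by
  classical
  refine ⟨fun c => if Δ₂ c = finT then Δ₃ c else Δ₂ c, fun c => ?_, fun c => ?_⟩ <;>
    rcases h c with ⟨a, b⟩ | ⟨a, b⟩ <;> rcases h' c with ⟨a', b'⟩ | ⟨a', b'⟩ <;>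
    by_cases e : Δ₂ c = finT <;> simp_all

theorem Disj.update {Δ Δ₁ Δ₂ : Typ} (h : Disj Δ Δ₁ Δ₂) {c : Chan} (hc : Δ₁ c ≠ finT)
    (t : LTree) : Disj (Function.update Δ c t) (Function.update Δ₁ c t) Δ₂ := by
  intro a
  by_cases ha : a = c
  · subst ha
    exact Or.inr ⟨(h.left hc).2, by simp⟩
  · simpa [ha] using h a

theorem Single.update {Δ : Typ} (h : Single Δ) {c : Chan} (hc : Δ c ≠ finT) (t : LTree) :
    Single (Function.update Δ c t) := by
  have key : ∀ a, Function.update Δ c t a ≠ finT → Δ a ≠ finT := by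
    intro a ha
    by_cases e : a = c
    · exact e ▸ hc
    · simpa [e] using ha
  exact fun a a' ha ha' => h a a' (key a ha) (key a' ha')

theorem Single.addSess_fin {Δ : Typ} (h : Single Δ) {U : Role → LTree} (hU : ∀ r, U r = finT) :
    Single (addSess Δ U) := by
  rintro (y | ⟨_ | s, r⟩) (y' | ⟨_ | s', r'⟩) hc hc' <;>
    first
    | exact absurd (hU _) hc
    | exact absurd (hU _) hc'
    | simpa using h _ _ hc hc'

theorem addSess_ren_succ (Δ : Typ) (U : Role → LTree) (c : Chan) :
    addSess Δ U (c.ren Nat.succ) = Δ c := by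
  cases c <;> rfl

theorem chan_cases (c : Chan) : (∃ r, c = .role 0 r) ∨ ∃ a : Chan, c = a.ren Nat.succ := by
  rcases c with y | ⟨_ | s, r⟩
  · exact Or.inr ⟨.var y, rfl⟩
  · exact Or.inl ⟨r, rfl⟩
  · exact Or.inr ⟨.role s r, rfl⟩

theorem addSess_eta (Δ : Typ) :
    Δ = addSess (fun c => Δ (c.ren Nat.succ)) (fun r => Δ (.role 0 r)) := by
  funext c
  rcases c with y | ⟨_ | s, r⟩ <;> rfl

theorem Disj.addSess {Δ Δ₁ Δ₂ : Typ} (h : Disj Δ Δ₁ Δ₂) {U U₁ U₂ : Role → LTree}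
    (hU : ∀ r, (U₁ r = finT ∧ U r = U₂ r) ∨ (U₂ r = finT ∧ U r = U₁ r)) :
    Disj (addSess Δ U) (addSess Δ₁ U₁) (addSess Δ₂ U₂) := by
  rintro (y | ⟨_ | s, r⟩)
  · exact h _
  · exact hU r
  · exact h _

theorem chan_ren_injective {f : ℕ → ℕ} (hf : f.Injective) :
    Function.Injective (Chan.ren f) := by
  rintro (y | ⟨s, r⟩) (y' | ⟨s', r'⟩) h <;> simp_all [Chan.ren]
  exact hf h.1

theorem up_injective {f : ℕ → ℕ} (hf : f.Injective) : (up f).Injective := by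
  rintro (_ | a) (_ | b) h <;> simp_all [up]
  exact hf h

theorem addSess_comp_ren (Δ : Typ) (U : Role → LTree) (f : ℕ → ℕ) :
    (fun c : Chan => addSess Δ U (c.ren (up f))) = addSess (fun c => Δ (c.ren f)) U := by
  funext c
  rcases c with y | ⟨_ | s, r⟩ <;> rfl

theorem inRange_addSess {Δ : Typ} {U : Role → LTree} {f : ℕ → ℕ} :
    InRange (up f) (addSess Δ U) ↔ InRange f Δ := by
  constructor
  · intro h a ha
    obtain ⟨c, hc⟩ := h (a.ren Nat.succ) (by rwa [addSess_ren_succ])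
    rcases c with y | ⟨_ | s, r⟩
    · refine ⟨.var y, ?_⟩
      cases a <;> simp_all [Chan.ren]
    · cases a <;> simp [Chan.ren, up] at hc
    · refine ⟨.role s r, ?_⟩
      cases a <;> simp_all [Chan.ren, up]
  · intro h
    rintro (y | ⟨_ | s, r⟩) ha
    · exact ⟨.var y, rfl⟩
    · exact ⟨.role 0 r, rfl⟩
    · obtain ⟨c, hc⟩ := h (.role s r) ha
      cases c with
      | var => simp [Chan.ren] at hc
      | role s' r' => exact ⟨.role (s' + 1) r', by simp_all [Chan.ren, up]⟩

theorem paramTyp_ne {T : List LTree} {c : Chan} (h : paramTyp T c ≠ finT) :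
    ∃ y, c = .var y ∧ y < T.length := by
  cases c with
  | var y =>
    refine ⟨y, rfl, ?_⟩
    by_contra hy
    exact h (by simp [paramTyp, List.getD, List.getElem?_eq_none (not_lt.mp hy)])
  | role s r => exact absurd rfl h

theorem inRange_paramTyp (f : ℕ → ℕ) (T : List LTree) : InRange f (paramTyp T) := by
  intro a ha
  obtain ⟨y, rfl, -⟩ := paramTyp_ne ha
  exact ⟨.var y, rfl⟩

theorem paramTyp_comp_ren (f : ℕ → ℕ) (T : List LTree) :
    (fun c : Chan => paramTyp T (c.ren f)) = paramTyp T := by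
  funext c
  cases c <;> rfl

namespace Carry

variable {φ ψ : Chan → Chan} {Δ Δ' Δ'' : Typ}

theorem congr (h : Carry φ Δ Δ') (e : ∀ c, Δ c ≠ finT → φ c = ψ c) : Carry ψ Δ Δ' where
  map c hc := e c hc ▸ h.map c hc
  surj a ha := by
    obtain ⟨c, hc, rfl⟩ := h.surj a ha
    exact ⟨c, hc, (e c hc).symm⟩
  inj c c' hc hc' he := h.inj c c' hc hc' (by rw [e c hc, e c' hc', he])

theorem ident (e : ∀ c, Δ c ≠ finT → φ c = c) : Carry φ Δ Δ :=
  Carry.congr (φ := fun c => c) ⟨fun _ _ => rfl, fun a ha => ⟨a, ha, rfl⟩, fun _ _ _ _ h => h⟩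
    fun c hc => (e c hc).symm

theorem comp (h : Carry φ Δ Δ') (h' : Carry ψ Δ' Δ'') : Carry (fun c => ψ (φ c)) Δ Δ'' where
  map c hc := by rw [h'.map _ (by rwa [h.map c hc]), h.map c hc]
  surj a ha := by
    obtain ⟨b, hb, rfl⟩ := h'.surj a ha
    obtain ⟨c, hc, rfl⟩ := h.surj b hb
    exact ⟨c, hc, rfl⟩
  inj c c' hc hc' he := h.inj c c' hc hc'
    (h'.inj _ _ (by rwa [h.map c hc]) (by rwa [h.map c' hc']) he)

theorem single (h : Carry φ Δ Δ') (hs : Single Δ) : Single Δ' := by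
  intro a a' ha ha'
  obtain ⟨c, hc, rfl⟩ := h.surj a ha
  obtain ⟨c', hc', rfl⟩ := h.surj a' ha'
  rw [hs c c' hc hc']

theorem fin (h : Carry φ Δ Δ') (hΔ : ∀ c, Δ c = finT) (a : Chan) : Δ' a = finT := by
  by_contra ha
  obtain ⟨c, hc, -⟩ := h.surj a ha
  exact hc (hΔ c)

/-- By injectivity, no other channel in use is sent to the updated one. -/
theorem update (h : Carry φ Δ Δ') {c : Chan} (hc : Δ c ≠ finT) (t : LTree) :
    Carry φ (Function.update Δ c t) (Function.update Δ' (φ c) t) := by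
  have key : ∀ a, Function.update Δ c t a ≠ finT → Δ a ≠ finT := by
    intro a ha
    by_cases e : a = c
    · exact e ▸ hc
    · simpa [e] using ha
  refine ⟨fun a ha => ?_, fun a ha => ?_, fun a a' ha ha' => h.inj a a' (key a ha) (key a' ha')⟩
  · by_cases e : a = c
    · simp [e]
    · have e' : φ a ≠ φ c := fun e' => e (h.inj a c (key a ha) hc e')
      simpa [e, e'] using h.map a (key a ha)
  · by_cases e : a = φ c
    · subst e
      exact ⟨c, by simpa using ha, rfl⟩
    · obtain ⟨b, hb, rfl⟩ := h.surj a (by simpa [e] using ha)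
      have e' : b ≠ c := fun e' => e (e' ▸ rfl)
      exact ⟨b, by simpa [e'] using hb, rfl⟩

/-- Each part of `Δ'` is cut out by the image of the channels in use in a part of `Δ`. Injectivity
makes the images disjoint, and surjectivity makes them cover `Δ'`. -/
theorem split (h : Carry φ Δ Δ') {Δ₁ Δ₂ : Typ} (hd : Disj Δ Δ₁ Δ₂) :
    ∃ Δ₁' Δ₂', Disj Δ' Δ₁' Δ₂' ∧ Carry φ Δ₁ Δ₁' ∧ Carry φ Δ₂ Δ₂' := by
  classical
  let part (D : Typ) : Typ := fun a => if ∃ c, D c ≠ finT ∧ φ c = a then Δ' a else finT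
  have main : ∀ D : Typ, (∀ c, D c ≠ finT → Δ c = D c) → Carry φ D (part D) := by
    intro D hD
    have hne : ∀ c, D c ≠ finT → Δ c ≠ finT := fun c hc => hD c hc ▸ hc
    refine ⟨fun c hc => ?_, fun a ha => ?_, fun c c' hc hc' => h.inj c c' (hne c hc) (hne c' hc')⟩
    · have : ∃ c', D c' ≠ finT ∧ φ c' = φ c := ⟨c, hc, rfl⟩
      simp only [part, if_pos this]
      rw [h.map c (hne c hc), hD c hc]
    · by_contra hn
      exact ha (if_neg hn)
  refine ⟨part Δ₁, part Δ₂, fun a => ?_, main _ fun c hc => (hd.left hc).1,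
    main _ fun c hc => (hd.right hc).1⟩
  by_cases h₁ : ∃ c, Δ₁ c ≠ finT ∧ φ c = a
  · right
    have h₂ : ¬ ∃ c, Δ₂ c ≠ finT ∧ φ c = a := by
      rintro ⟨c, hc, rfl⟩
      obtain ⟨c', hc', e⟩ := h₁
      have := h.inj c' c ((hd.left hc').1 ▸ hc') ((hd.right hc).1 ▸ hc) e
      subst this
      exact hc (hd.left hc').2
    exact ⟨if_neg h₂, (if_pos h₁).symm⟩
  · left
    refine ⟨if_neg h₁, ?_⟩
    by_cases h₂ : ∃ c, Δ₂ c ≠ finT ∧ φ c = a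
    · exact (if_pos h₂).symm
    · simp only [part, if_neg h₂]
      by_contra ha
      obtain ⟨c, hc, rfl⟩ := h.surj a ha
      rcases hd.exists_ne hc with hc | hc
      · exact h₁ ⟨c, hc, rfl⟩
      · exact h₂ ⟨c, hc, rfl⟩

theorem addSess (h : Carry φ Δ Δ') (U : Role → LTree) (h₀ : ∀ r, ψ (.role 0 r) = .role 0 r)
    (hs : ∀ c : Chan, ψ (c.ren Nat.succ) = (φ c).ren Nat.succ) :
    Carry ψ (addSess Δ U) (addSess Δ' U) := by
  have hi := chan_ren_injective Nat.succ_injective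
  have h0s : ∀ (r : Role) (c : Chan), .role 0 r ≠ c.ren Nat.succ := by
    rintro r (y | ⟨s, r'⟩) <;> simp [Chan.ren]
  refine ⟨fun c hc => ?_, fun a ha => ?_, fun c c' hc hc' he => ?_⟩
  · rcases chan_cases c with ⟨r, rfl⟩ | ⟨b, rfl⟩
    · rw [h₀]; rfl
    · rw [addSess_ren_succ] at hc ⊢
      rw [hs, addSess_ren_succ, h.map b hc]
  · rcases chan_cases a with ⟨r, rfl⟩ | ⟨b, rfl⟩
    · exact ⟨.role 0 r, ha, h₀ r⟩
    · rw [addSess_ren_succ] at ha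
      obtain ⟨c, hc, rfl⟩ := h.surj b ha
      exact ⟨c.ren Nat.succ, by rwa [addSess_ren_succ], hs c⟩
  · rcases chan_cases c with ⟨r, rfl⟩ | ⟨b, rfl⟩ <;> rcases chan_cases c' with ⟨r', rfl⟩ | ⟨b', rfl⟩
    · simpa [h₀] using he
    · rw [h₀, hs] at he
      exact absurd he (h0s _ _)
    · rw [h₀, hs] at he
      exact absurd he.symm (h0s _ _)
    · rw [hs, hs] at he
      rw [addSess_ren_succ] at hc hc'
      rw [h.inj b b' hc hc' (hi he)]

theorem comp_ren_iff {f : ℕ → ℕ} (hf : f.Injective) :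
    Carry (fun c => (φ c).ren f) Δ Δ' ↔ Carry φ Δ (fun c => Δ' (c.ren f)) ∧
      InRange f Δ' := by
  constructor
  · intro h
    refine ⟨⟨fun c hc => h.map c hc, fun a ha => ?_, fun c c' hc hc' he =>
      h.inj c c' hc hc' (by rw [he])⟩, fun a ha => ?_⟩
    · obtain ⟨c, hc, e⟩ := h.surj _ ha
      exact ⟨c, hc, chan_ren_injective hf e⟩
    · obtain ⟨c, -, e⟩ := h.surj a ha
      exact ⟨_, e⟩
  · rintro ⟨h, hr⟩
    refine ⟨fun c hc => h.map c hc, fun a ha => ?_, fun c c' hc hc' he =>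
      h.inj c c' hc hc' (chan_ren_injective hf he)⟩
    obtain ⟨b, rfl⟩ := hr a ha
    obtain ⟨c, hc, rfl⟩ := h.surj b ha
    exact ⟨c, hc, rfl⟩

end Carry

/-- A parameter in use has an index within the list, so the default value of `instC`, with which `h`
need not be compatible, never arises. -/
theorem subst_instC_map {c : List Chan} {h : Chan → Chan} {T : List LTree} (hl : T.length = c.length)
    {a : Chan} (ha : paramTyp T a ≠ finT) :
    a.subst (instC (c.map h)) = h (a.subst (instC c)) := by
  obtain ⟨y, rfl, hy⟩ := paramTyp_ne ha
  have hy' : y < c.length := hl ▸ hy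
  simp [Chan.subst, instC, List.getD, List.getElem?_eq_getElem hy']

/-! ### The typing invariant -/

/-- Disciplines for sessions: `full` allows a process to play all roles of coherent sessions,
`inner` forbids to use restricted sessions, and `top` allows a single channel at each active prefix
or call, with the discipline `inner` below. -/
inductive Mode where
  | full | inner | top

/-- The discipline for guarded subprocesses and declarations. -/
def Mode.next : Mode → Mode
  | full => full
  | _ => inner

/-- The condition on restricted sessions. -/
def Mode.Sess : Mode → (Role → LTree) → Prop
  | inner, U => ∀ r, U r = finT
  | _, U => Coherent U

/-- The condition on active prefixes and calls. -/
def Mode.Leaf : Mode → Typ → Prop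
  | top, Δ => Single Δ
  | _, _ => True

theorem Mode.Sess.of_fin {U : Role → LTree} (h : ∀ r, U r = finT) : ∀ m : Mode, m.Sess U
  | full => Coherent.of_fin h
  | inner => h
  | top => Coherent.of_fin h

theorem Mode.Leaf.carry {m : Mode} {φ : Chan → Chan} {Δ Δ' : Typ} (h : m.Leaf Δ)
    (hc : Carry φ Δ Δ') : m.Leaf Δ' := by
  cases m
  · trivial
  · trivial
  · exact hc.single h

theorem Mode.leaf_ren {m : Mode} {f : ℕ → ℕ} (hf : f.Injective) {Δ : Typ} (hr : InRange f Δ) :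
    m.Leaf Δ ↔ m.Leaf (fun c => Δ (c.ren f)) := by
  cases m
  · rfl
  · rfl
  · constructor
    · intro h c c' hc hc'
      exact chan_ren_injective hf (h _ _ hc hc')
    · intro h a a' ha ha'
      obtain ⟨c, rfl⟩ := hr a ha
      obtain ⟨c', rfl⟩ := hr a' ha'
      rw [h c c' ha ha']

/-- Types of the process variables: the number of value parameters and the types of the channel
parameters; a variable without type cannot be called. -/
abbrev PEnv := ℕ → Option (ℕ × List LTree)

/-- Extension of an environment by the innermost variable. -/
def PEnv.cons (e : Option (ℕ × List LTree)) (Ξ : PEnv) : PEnv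
  | 0 => e
  | X + 1 => Ξ X

/-- The typing invariant. It ignores the sorts of values, and does not constrain definitions that
are never called. -/
def WT : Mode → PEnv → Proc → Typ → Prop
  | _, _, .nil, Δ => ∀ c, Δ c = finT
  | m, Ξ, .par P Q, Δ => ∃ Δ₁ Δ₂, Disj Δ Δ₁ Δ₂ ∧ WT m Ξ P Δ₁ ∧ WT m Ξ Q Δ₂
  | m, Ξ, .sel c r I _ _ _ P, Δ => m.Leaf Δ ∧ Δ c [] = .sel r I ∧
      ∀ i, WT m.next Ξ (P i) (Function.update Δ c (child (Δ c) i))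
  | m, Ξ, .bra c r I _ P, Δ => m.Leaf Δ ∧ Δ c [] = .bra r I ∧
      ∀ i, WT m.next Ξ (P i) (Function.update Δ c (child (Δ c) i))
  | m, Ξ, .nu _ P, Δ => ∃ U, m.Sess U ∧ WT m Ξ P (addSess Δ U)
  | m, Ξ, .defn n k B P, Δ => ∃ e : Option (List LTree),
      (∀ T ∈ e, T.length = k ∧ WT m.next (Ξ.cons (some (n, T))) B (paramTyp T)) ∧
      WT m (Ξ.cons (e.map (Prod.mk n))) P Δ
  | m, Ξ, .call X v c, Δ => m.Leaf Δ ∧ ∃ T, Ξ X = some (v.length, T) ∧ T.length = c.length ∧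
      Carry (Chan.subst (instC c)) (paramTyp T) Δ

/-! ### Renaming and substitution in the invariant. -/

theorem update_comp_ren {f : ℕ → ℕ} (hf : f.Injective) (Δ : Typ) (c : Chan) (t : LTree) :
    (fun a : Chan => Function.update Δ (c.ren f) t (a.ren f)) =
      Function.update (fun a => Δ (a.ren f)) c t := by
  funext a
  by_cases e : a = c
  · simp [e]
  · simp [e, (chan_ren_injective hf).ne e]

theorem inRange_update {f : ℕ → ℕ} {Δ : Typ} {c : Chan} {t : LTree} :
    InRange f (Function.update Δ (c.ren f) t) ↔ InRange f Δ := by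
  constructor <;> intro h a ha <;> by_cases e : a = c.ren f
  · exact ⟨c, e.symm⟩
  · exact h a (by simpa [e] using ha)
  · exact ⟨c, e.symm⟩
  · exact h a (by simpa [e] using ha)

theorem PEnv.cons_up {e : Option (ℕ × List LTree)} {Ξ Ξ' : PEnv} {g : ℕ → ℕ}
    (h : ∀ X, Ξ' (g X) = Ξ X) : ∀ X, Ξ'.cons e (up g X) = Ξ.cons e X
  | 0 => rfl
  | X + 1 => h X

/-- An equivalence, because congruence moves processes both into and out of the scope of a binder.
`InRange` records that a renamed process can only use renamed channels. -/
theorem WT_ren {P : Proc} {m : Mode} {Ξ Ξ' : PEnv} {Δ : Typ} {f g : ℕ → ℕ} (hf : f.Injective)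
    (hg : ∀ X, Ξ' (g X) = Ξ X) :
    WT m Ξ' (P.ren f g) Δ ↔ WT m Ξ P (fun c => Δ (c.ren f)) ∧ InRange f Δ := by
  induction P generalizing m Ξ Ξ' Δ f g with
  | nil =>
    refine ⟨fun h => ⟨fun c => h _, fun a ha => absurd (h a) ha⟩, fun ⟨h, hr⟩ a => ?_⟩
    by_contra ha
    obtain ⟨c, rfl⟩ := hr a ha
    exact ha (h c)
  | par P Q ihP ihQ =>
    constructor
    · rintro ⟨Δ₁, Δ₂, hd, h₁, h₂⟩
      rw [ihP hf hg] at h₁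
      rw [ihQ hf hg] at h₂
      refine ⟨⟨_, _, fun c => hd _, h₁.1, h₂.1⟩, fun a ha => ?_⟩
      rcases hd.exists_ne ha with ha | ha
      · exact h₁.2 a ha
      · exact h₂.2 a ha
    · rintro ⟨⟨Δ₁, Δ₂, hd, h₁, h₂⟩, hr⟩
      have hi := chan_ren_injective hf
      -- The two parts are pushed along the renaming and filled up with `end` outside its range.
      have he : ∀ D : Typ, (fun c : Chan =>
          Function.extend (Chan.ren f) D (fun _ => finT) (c.ren f)) = D := by
        intro D
        funext c
        exact hi.extend_apply _ _ _
      have hr' : ∀ D : Typ, InRange f (Function.extend (Chan.ren f) D (fun _ => finT)) := by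
        intro D a ha
        by_contra hn
        exact ha (Function.extend_apply' _ _ _ hn)
      refine ⟨Function.extend (Chan.ren f) Δ₁ (fun _ => finT),
        Function.extend (Chan.ren f) Δ₂ (fun _ => finT), fun a => ?_,
        (ihP hf hg).2 ⟨by rwa [he], hr' _⟩, (ihQ hf hg).2 ⟨by rwa [he], hr' _⟩⟩
      by_cases ha : ∃ c : Chan, c.ren f = a
      · obtain ⟨c, rfl⟩ := ha
        rw [hi.extend_apply, hi.extend_apply]
        exact hd c
      · left
        rw [Function.extend_apply' _ _ _ ha, Function.extend_apply' _ _ _ ha]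
        exact ⟨rfl, by_contra fun hn => ha (hr a hn)⟩
  | sel c r I hI p v P ih =>
    simp only [Proc.ren, WT, ih _ hf hg, update_comp_ren hf, inRange_update]
    constructor
    · rintro ⟨hl, hs, h⟩
      have hr : InRange f Δ := (h ⟨_, hI.choose_spec⟩).2
      exact ⟨⟨(Mode.leaf_ren hf hr).1 hl, hs, fun i => (h i).1⟩, hr⟩
    · rintro ⟨⟨hl, hs, h⟩, hr⟩
      exact ⟨(Mode.leaf_ren hf hr).2 hl, hs, fun i => ⟨h i, hr⟩⟩
  | bra c r I hI P ih =>
    simp only [Proc.ren, WT, ih _ hf hg, update_comp_ren hf, inRange_update]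
    constructor
    · rintro ⟨hl, hs, h⟩
      have hr : InRange f Δ := (h ⟨_, hI.choose_spec⟩).2
      exact ⟨⟨(Mode.leaf_ren hf hr).1 hl, hs, fun i => (h i).1⟩, hr⟩
    · rintro ⟨⟨hl, hs, h⟩, hr⟩
      exact ⟨(Mode.leaf_ren hf hr).2 hl, hs, fun i => ⟨h i, hr⟩⟩
  | nu G P ih =>
    simp only [Proc.ren, WT, ih (up_injective hf) hg, addSess_comp_ren, inRange_addSess]
    constructor
    · rintro ⟨U, hU, h, hr⟩
      exact ⟨⟨U, hU, h⟩, hr⟩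
    · rintro ⟨⟨U, hU, h⟩, hr⟩
      exact ⟨U, hU, h, hr⟩
  | defn n k B P ihB ihP =>
    have hB : ∀ T, WT m.next (Ξ'.cons (some (n, T))) (B.ren f (up g)) (paramTyp T) ↔
        WT m.next (Ξ.cons (some (n, T))) B (paramTyp T) := by
      intro T
      rw [ihB hf (PEnv.cons_up hg), paramTyp_comp_ren]
      exact and_iff_left (inRange_paramTyp f T)
    simp only [Proc.ren, WT, hB, ihP hf (PEnv.cons_up hg)]
    constructor
    · rintro ⟨e, he, h, hr⟩
      exact ⟨⟨e, he, h⟩, hr⟩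
    · rintro ⟨⟨e, he, h⟩, hr⟩
      exact ⟨e, he, h, hr⟩
  | call X v c =>
    simp only [Proc.ren, WT, hg, List.length_map]
    have key : ∀ T : List LTree, T.length = c.length →
        (Carry (Chan.subst (instC (c.map (Chan.ren f)))) (paramTyp T) Δ ↔
          Carry (Chan.subst (instC c)) (paramTyp T) (fun a => Δ (a.ren f)) ∧ InRange f Δ) := by
      intro T hT
      rw [← Carry.comp_ren_iff hf]
      exact ⟨fun h => h.congr fun a ha => subst_instC_map hT ha,
        fun h => h.congr fun a ha => (subst_instC_map hT ha).symm⟩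
    constructor
    · rintro ⟨hl, T, hX, hT, h⟩
      obtain ⟨h, hr⟩ := (key T hT).1 h
      exact ⟨⟨(Mode.leaf_ren hf hr).1 hl, T, hX, hT, h⟩, hr⟩
    · rintro ⟨⟨hl, T, hX, hT, h⟩, hr⟩
      exact ⟨(Mode.leaf_ren hf hr).2 hl, T, hX, hT, (key T hT).2 ⟨h, hr⟩⟩

theorem WT_renS {P : Proc} {m : Mode} {Ξ : PEnv} {Δ : Typ} {f : ℕ → ℕ} (hf : f.Injective) :
    WT m Ξ (P.renS f) Δ ↔ WT m Ξ P (fun c => Δ (c.ren f)) ∧ InRange f Δ :=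
  WT_ren hf fun _ => rfl

theorem WT_renX {P : Proc} {m : Mode} {Ξ Ξ' : PEnv} {Δ : Typ} {g : ℕ → ℕ}
    (hg : ∀ X, Ξ' (g X) = Ξ X) : WT m Ξ' (P.renX g) Δ ↔ WT m Ξ P Δ := by
  have hid : ∀ c : Chan, c.ren id = c := by rintro (y | ⟨s, r⟩) <;> rfl
  rw [Proc.renX, WT_ren Function.injective_id hg]
  simp only [hid]
  exact and_iff_left fun a _ => ⟨a, hid a⟩

/-- A prefix acts on a channel whose tree is not `end`, and there `Carry` controls the image.
Channels not in use may be mapped anywhere. -/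
theorem WT.subst {P : Proc} {m : Mode} {Ξ : PEnv} {Δ Δ' : Typ} {σ : ℕ → Val} {τ : ℕ → Chan}
    (h : WT m Ξ P Δ) (hc : Carry (Chan.subst τ) Δ Δ') : WT m Ξ (P.subst σ τ) Δ' := by
  induction P generalizing m Ξ Δ Δ' σ τ with
  | nil => exact hc.fin h
  | par P Q ihP ihQ =>
    obtain ⟨Δ₁, Δ₂, hd, h₁, h₂⟩ := h
    obtain ⟨Δ₁', Δ₂', hd', hc₁, hc₂⟩ := hc.split hd
    exact ⟨Δ₁', Δ₂', hd', ihP h₁ hc₁, ihQ h₂ hc₂⟩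
  | sel c r I hI p v P ih =>
    obtain ⟨hl, hs, h⟩ := h
    have hne := ne_finT_of_sel hs
    refine ⟨hl.carry hc, by rw [hc.map c hne, hs], fun i => ih i (h i) ?_⟩
    rw [hc.map c hne]
    exact hc.update hne _
  | bra c r I hI P ih =>
    obtain ⟨hl, hs, h⟩ := h
    have hne := ne_finT_of_bra hs
    refine ⟨hl.carry hc, by rw [hc.map c hne, hs], fun i => ih i (h i) ?_⟩
    rw [hc.map c hne]
    exact hc.update hne _
  | nu G P ih =>
    obtain ⟨U, hU, h⟩ := h
    refine ⟨U, hU, ih h (hc.addSess U (fun _ => rfl) ?_)⟩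
    rintro (y | ⟨s, r⟩) <;> rfl
  | defn n k B P ihB ihP =>
    obtain ⟨e, he, h⟩ := h
    -- The body uses only channel variables below `k`, which the lifted substitution fixes.
    refine ⟨e, fun T hT => ⟨(he T hT).1, ihB (he T hT).2 (Carry.ident fun c hc => ?_)⟩, ihP h hc⟩
    obtain ⟨y, rfl, hy⟩ := paramTyp_ne hc
    have := (he T hT).1
    simp [Chan.subst, liftC, show y < k by omega]
  | call X v c =>
    obtain ⟨hl, T, hX, hT, h⟩ := h
    refine ⟨hl.carry hc, T, by simpa using hX, by simpa using hT, ?_⟩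
    exact (h.comp hc).congr fun a ha => (subst_instC_map hT ha).symm

/-! ### Changes of discipline. -/

/-- Below prefixes the two disciplines agree. In the active part, splitting creates no channels and
restricted sessions are not used, so a single channel stays single. -/
theorem WT.top_of_inner {P : Proc} {Ξ : PEnv} {Δ : Typ} (h : WT .inner Ξ P Δ) (hs : Single Δ) :
    WT .top Ξ P Δ := by
  induction P generalizing Ξ Δ with
  | nil => exact h
  | par P Q ihP ihQ =>
    obtain ⟨Δ₁, Δ₂, hd, h₁, h₂⟩ := h
    exact ⟨Δ₁, Δ₂, hd, ihP h₁ (hd.single_left hs), ihQ h₂ (hd.symm.single_left hs)⟩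
  | sel c r I hI p v P ih => exact ⟨hs, h.2⟩
  | bra c r I hI P ih => exact ⟨hs, h.2⟩
  | nu G P ih =>
    obtain ⟨U, hU, h⟩ := h
    exact ⟨U, Coherent.of_fin hU, ih h (hs.addSess_fin hU)⟩
  | defn n k B P ihB ihP =>
    obtain ⟨e, he, h⟩ := h
    exact ⟨e, he, ihP h hs⟩
  | call X v c => exact ⟨hs, h.2⟩

/-- A channel in use must occur in the process, on a prefix or as an argument of a call, since
inaction requires `end` everywhere. Under a restriction the permitted session has index `s + 1`, so
the new session `0` is not used. -/
theorem WT.inner_of_onlyOn {P : Proc} {Ξ : PEnv} {Δ : Typ} {s : ℕ} {r : Role}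
    (h : WT .full Ξ P Δ) (ho : P.OnlyOn s r) :
    WT .inner Ξ P Δ ∧ ∀ s' r', Δ (.role s' r') ≠ finT → s' = s ∧ r' = r := by
  induction P generalizing Ξ Δ s with
  | nil => exact ⟨h, fun s' r' hn => absurd (h _) hn⟩
  | par P Q ihP ihQ =>
    obtain ⟨Δ₁, Δ₂, hd, h₁, h₂⟩ := h
    obtain ⟨h₁, hr₁⟩ := ihP h₁ ho.1
    obtain ⟨h₂, hr₂⟩ := ihQ h₂ ho.2
    refine ⟨⟨Δ₁, Δ₂, hd, h₁, h₂⟩, fun s' r' hn => ?_⟩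
    rcases hd.exists_ne hn with hn | hn
    · exact hr₁ s' r' hn
    · exact hr₂ s' r' hn
  | sel c r' I hI p v P ih =>
    obtain ⟨-, hs, h⟩ := h
    have key := fun i => ih i (h i) (ho.2 i)
    refine ⟨⟨trivial, hs, fun i => (key i).1⟩, fun s' r' hn => ?_⟩
    by_cases e : Chan.role s' r' = c
    · exact ho.1 s' r' e.symm
    · exact (key ⟨_, hI.choose_spec⟩).2 s' r' (by simpa [e] using hn)
  | bra c r' I hI P ih =>
    obtain ⟨-, hs, h⟩ := h
    have key := fun i => ih i (h i) (ho.2 i)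
    refine ⟨⟨trivial, hs, fun i => (key i).1⟩, fun s' r' hn => ?_⟩
    by_cases e : Chan.role s' r' = c
    · exact ho.1 s' r' e.symm
    · exact (key ⟨_, hI.choose_spec⟩).2 s' r' (by simpa [e] using hn)
  | nu G P ih =>
    obtain ⟨U, hU, h⟩ := h
    obtain ⟨h, hr⟩ := ih h ho
    refine ⟨⟨U, fun r' => ?_, h⟩, fun s' r' hn => ?_⟩
    · by_contra hn
      exact absurd (hr 0 r' hn).1 (by omega)
    · obtain ⟨e, e'⟩ := hr (s' + 1) r' hn
      exact ⟨by omega, e'⟩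
  | defn n k B P ihB ihP =>
    obtain ⟨e, he, h⟩ := h
    obtain ⟨h, hr⟩ := ihP h ho.2
    exact ⟨⟨e, fun T hT => ⟨(he T hT).1, (ihB (he T hT).2 ho.1).1⟩, h⟩, hr⟩
  | call X v c =>
    obtain ⟨-, T, hX, hT, h⟩ := h
    refine ⟨⟨trivial, T, hX, hT, h⟩, fun s' r' hn => ho s' r' ?_⟩
    obtain ⟨a, ha, e⟩ := h.surj _ hn
    obtain ⟨y, rfl, hy⟩ := paramTyp_ne ha
    have hy' : y < c.length := hT ▸ hy
    simp only [Chan.subst, instC, List.getD, List.getElem?_eq_getElem hy', Option.getD_some] at e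
    exact e ▸ List.getElem_mem hy'


/-! ### Invariance under structural congruence -/

theorem swap01_injective : swap01.Injective := by
  rintro (_ | _ | a) (_ | _ | b) h <;> simp_all [swap01]

theorem swap01_swap01 (n : ℕ) : swap01 (swap01 n) = n := by
  rcases n with _ | _ | n <;> rfl

theorem addSess_swap (Δ : Typ) (U U' : Role → LTree) :
    (fun c : Chan => addSess (addSess Δ U') U (c.ren swap01)) = addSess (addSess Δ U) U' := by
  funext c
  rcases c with y | ⟨_ | _ | s, r⟩ <;> rfl

theorem inRange_swap01 (Δ : Typ) : InRange swap01 Δ := by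
  rintro (y | ⟨s, r⟩) -
  · exact ⟨.var y, rfl⟩
  · exact ⟨.role (swap01 s) r, by simp [Chan.ren, swap01_swap01]⟩

theorem addSess_comp_ren_succ (Δ : Typ) (U : Role → LTree) :
    (fun c : Chan => addSess Δ U (c.ren Nat.succ)) = Δ :=
  funext fun c => addSess_ren_succ Δ U c

theorem inRange_succ_iff {Δ : Typ} : InRange Nat.succ Δ ↔ ∀ r, Δ (.role 0 r) = finT := by
  constructor
  · intro h r
    by_contra hn
    obtain ⟨c, hc⟩ := h _ hn
    cases c <;> simp [Chan.ren] at hc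
  · intro h a ha
    rcases chan_cases a with ⟨r, rfl⟩ | ⟨b, rfl⟩
    · exact absurd (h r) ha
    · exact ⟨b, rfl⟩

theorem inRange_succ_addSess (Δ : Typ) : InRange Nat.succ (addSess Δ fun _ => finT) :=
  inRange_succ_iff.2 fun _ => rfl

/-- A shifted process has `end` for all roles of the new session, so the whole session belongs to
the other component. -/
theorem wt_nuPar {m : Mode} {Ξ : PEnv} {G : GType} {P Q : Proc} {Δ : Typ} :
    WT m Ξ (.par (.nu G P) Q) Δ ↔ WT m Ξ (.nu G (.par P (Q.renS Nat.succ))) Δ := by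
  constructor
  · rintro ⟨Δ₁, Δ₂, hd, ⟨U, hU, h₁⟩, h₂⟩
    refine ⟨U, hU, addSess Δ₁ U, addSess Δ₂ fun _ => finT,
      hd.addSess fun r => Or.inr ⟨rfl, rfl⟩, h₁, ?_⟩
    rw [WT_renS Nat.succ_injective, addSess_comp_ren_succ]
    exact ⟨h₂, inRange_succ_addSess _⟩
  · rintro ⟨U, hU, Δ₁, Δ₂, hd, h₁, h₂⟩
    rw [WT_renS Nat.succ_injective, inRange_succ_iff] at h₂
    refine ⟨fun c => Δ₁ (c.ren Nat.succ), fun c => Δ₂ (c.ren Nat.succ), fun c => ?_,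
      ⟨U, hU, ?_⟩, h₂.1⟩
    · simpa [addSess_ren_succ] using hd (c.ren Nat.succ)
    · have hU₁ : U = fun r => Δ₁ (.role 0 r) := funext fun r => hd.eq_of_right (h₂.2 r)
      rwa [hU₁, ← addSess_eta]

theorem wt_nuSwap {m : Mode} {Ξ : PEnv} {G G' : GType} {P : Proc} {Δ : Typ} :
    WT m Ξ (.nu G (.nu G' P)) Δ ↔ WT m Ξ (.nu G' (.nu G (P.renS swap01))) Δ := by
  simp only [WT, WT_renS swap01_injective, addSess_swap, inRange_swap01, and_true]
  constructor <;> rintro ⟨U, hU, U', hU', h⟩ <;> exact ⟨U', hU', U, hU, h⟩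

theorem wt_nuNil {m : Mode} {Ξ : PEnv} {G : GType} {Δ : Typ} :
    WT m Ξ (.nu G .nil) Δ ↔ WT m Ξ .nil Δ := by
  constructor
  · rintro ⟨U, -, h⟩ c
    simpa [addSess_ren_succ] using h (c.ren Nat.succ)
  · intro h
    refine ⟨fun _ => finT, .of_fin (fun _ => rfl) m, ?_⟩
    rintro (y | ⟨_ | s, r⟩)
    · exact h _
    · rfl
    · exact h _

theorem wt_defNu {m : Mode} {Ξ : PEnv} {n k : ℕ} {B P : Proc} {G : GType} {Δ : Typ} :
    WT m Ξ (.defn n k B (.nu G P)) Δ ↔ WT m Ξ (.nu G (.defn n k (B.renS Nat.succ) P)) Δ := by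
  simp only [WT, WT_renS Nat.succ_injective, paramTyp_comp_ren, inRange_paramTyp, and_true]
  constructor
  · rintro ⟨e, he, U, hU, h⟩
    exact ⟨U, hU, e, he, h⟩
  · rintro ⟨U, hU, e, he, h⟩
    exact ⟨e, he, U, hU, h⟩

theorem wt_defPar {m : Mode} {Ξ : PEnv} {n k : ℕ} {B P Q : Proc} {Δ : Typ} :
    WT m Ξ (.defn n k B (.par P (Q.renX Nat.succ))) Δ ↔ WT m Ξ (.par (.defn n k B P) Q) Δ := by
  have hQ : ∀ (e : Option (ℕ × List LTree)) (D : Typ),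
      WT m (Ξ.cons e) (Q.renX Nat.succ) D ↔ WT m Ξ Q D := fun e D => WT_renX fun _ => rfl
  simp only [WT, hQ]
  constructor
  · rintro ⟨e, he, Δ₁, Δ₂, hd, h₁, h₂⟩
    exact ⟨Δ₁, Δ₂, hd, ⟨e, he, h₁⟩, h₂⟩
  · rintro ⟨Δ₁, Δ₂, hd, ⟨e, he, h₁⟩, h₂⟩
    exact ⟨e, he, Δ₁, Δ₂, hd, h₁, h₂⟩

theorem wt_defSwap {m : Mode} {Ξ : PEnv} {n k n' k' : ℕ} {B B' P : Proc} {Δ : Typ} :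
    WT m Ξ (.defn n k B (.defn n' k' (B'.renX (up Nat.succ)) P)) Δ ↔
      WT m Ξ (.defn n' k' B' (.defn n k (B.renX (up Nat.succ)) (P.renX swap01))) Δ := by
  have hB : ∀ (m : Mode) (A : Proc) (e e' : Option (ℕ × List LTree)) (D : Typ),
      WT m (PEnv.cons e' (Ξ.cons e)) (A.renX (up Nat.succ)) D ↔ WT m (Ξ.cons e') A D :=
    fun m A e e' D => WT_renX (PEnv.cons_up fun _ => rfl)
  have hP : ∀ (e e' : Option (ℕ × List LTree)),
      WT m (PEnv.cons e (Ξ.cons e')) (P.renX swap01) Δ ↔ WT m (PEnv.cons e' (Ξ.cons e)) P Δ :=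
    fun e e' => WT_renX (by rintro (_ | _ | X) <;> rfl)
  simp only [WT, hB, hP]
  constructor <;> rintro ⟨e, he, e', he', h⟩ <;> exact ⟨e', he', e, he, h⟩

theorem SCong.wt_iff {P Q : Proc} (h : SCong P Q) {m : Mode} {Ξ : PEnv} {Δ : Typ} :
    WT m Ξ P Δ ↔ WT m Ξ Q Δ := by
  induction h generalizing m Ξ Δ with
  | refl => rfl
  | symm _ ih => exact ih.symm
  | trans _ _ ih₁ ih₂ => exact ih₁.trans ih₂
  | parComm P Q =>
    constructor <;> rintro ⟨Δ₁, Δ₂, hd, h₁, h₂⟩ <;> exact ⟨Δ₂, Δ₁, hd.symm, h₂, h₁⟩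
  | parAssoc P Q R =>
    constructor
    · rintro ⟨Δ₁₂, Δ₃, hd, ⟨Δ₁, Δ₂, hd', h₁, h₂⟩, h₃⟩
      obtain ⟨Δ₂₃, hd₁, hd₂⟩ := hd.assoc hd'
      exact ⟨Δ₁, Δ₂₃, hd₁, h₁, Δ₂, Δ₃, hd₂, h₂, h₃⟩
    · rintro ⟨Δ₁, Δ₂₃, hd, h₁, Δ₂, Δ₃, hd', h₂, h₃⟩
      obtain ⟨Δ₁₂, hd₁, hd₂⟩ := hd.symm.assoc hd'.symm
      exact ⟨Δ₁₂, Δ₃, hd₁.symm, ⟨Δ₁, Δ₂, hd₂.symm, h₁, h₂⟩, h₃⟩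
  | parNil P =>
    constructor
    · rintro ⟨Δ₁, Δ₂, hd, h₁, h₂⟩
      rwa [hd.eq_of_fin h₂]
    · exact fun h => ⟨Δ, _, Disj.fin_right Δ, h, fun _ => rfl⟩
  | nuNil G => exact wt_nuNil
  | nuSwap => exact wt_nuSwap
  | nuPar => exact wt_nuPar
  -- From right to left `B` is arbitrary; leaving it untyped avoids any condition on it.
  | defNil n k B => exact ⟨fun ⟨_, _, h⟩ => h, fun h => ⟨none, by simp, h⟩⟩
  | defNu => exact wt_defNu
  | defPar => exact wt_defPar
  | defSwap => exact wt_defSwap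
  | par _ _ ih₁ ih₂ => simp only [WT, ih₁, ih₂]
  | sel c r I hI p v _ ih => simp only [WT, ih]
  | bra c r I hI _ ih => simp only [WT, ih]
  | nu G _ ih => simp only [WT, ih]
  | defn n k _ _ ih₁ ih₂ => simp only [WT, ih₁, ih₂]

/-! ### From the typing rules to the invariant -/

/-- The trees of the types in a typing. -/
noncomputable def Typing.toTyp (Δ : Typing) : Typ := fun c => (Δ c).elim finT LType.tree

/-- The environment of trees given by a sorting of process variables. -/
noncomputable def toPEnv (Ξ : List (List Srt × List LType)) : PEnv :=
  fun X => Ξ[X]?.map fun e => (e.1.length, e.2.map LType.tree)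

theorem Typing.toTyp_add (Δ : Typing) (c : Chan) (T : LType) :
    (Δ.add c T).toTyp = Function.update Δ.toTyp c T.tree := by
  funext a
  by_cases e : a = c
  · subst e
    simp [Typing.toTyp, Typing.add]
  · simp [Typing.toTyp, Typing.add, e]

theorem Typing.toTyp_eq {Δ : Typing} {c : Chan} {T : LType} (h : Δ c = some T) :
    Δ.toTyp c = T.tree := by
  simp [Typing.toTyp, h]

theorem Typing.toTyp_params (T : List LType) :
    (Typing.params T).toTyp = paramTyp (T.map LType.tree) := by
  funext c
  cases c with
  | var y => cases h : T[y]? <;> simp [Typing.toTyp, Typing.params, paramTyp, List.getD, h]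
  | role s r => rfl

theorem Typing.toTyp_addSession (Δ : Typing) (R : Finset Role) (T : Role → LType) :
    (Δ.addSession R T).toTyp = addSess Δ.toTyp fun r => if r ∈ R then (T r).tree else finT := by
  funext c
  rcases c with y | ⟨_ | s, r⟩
  · rfl
  · by_cases h : r ∈ R <;> simp [Typing.toTyp, Typing.addSession, addSess, h]
  · rfl

theorem toPEnv_cons (e : List Srt × List LType) (Ξ : List (List Srt × List LType)) :
    toPEnv (e :: Ξ) = (toPEnv Ξ).cons (some (e.1.length, e.2.map LType.tree)) := by
  funext X
  cases X <;> rfl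

/-- Injectivity comes from the arguments being distinct, surjectivity from the other channels having
type `end`. -/
theorem carry_call {Δ : Typing} {cs : List Chan} {T : List LType} (hn : cs.Nodup)
    (h : List.Forall₂ (fun a A => Δ a = some A) cs T)
    (hf : ∀ a, a ∉ cs → ∀ A, Δ a = some A → A = .fin) :
    Carry (Chan.subst (instC cs)) (paramTyp (T.map LType.tree)) Δ.toTyp := by
  have hl := h.length_eq
  have hc : ∀ y (hy : y < cs.length), (Chan.var y).subst (instC cs) = cs[y] := by
    intro y hy
    simp [Chan.subst, instC, List.getD, List.getElem?_eq_getElem hy]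
  have hT : ∀ y (hy : y < cs.length), Δ.toTyp cs[y] = paramTyp (T.map LType.tree) (.var y) := by
    intro y hy
    have hy' : y < T.length := hl ▸ hy
    have hg : Δ cs[y] = some T[y] := h.get hy hy'
    rw [Typing.toTyp_eq hg]
    simp [paramTyp, List.getD, List.getElem?_eq_getElem hy']
  have hy : ∀ {a : Chan}, paramTyp (T.map LType.tree) a ≠ finT →
      ∃ y, a = .var y ∧ y < cs.length := by
    intro a ha
    obtain ⟨y, rfl, hy⟩ := paramTyp_ne ha
    exact ⟨y, rfl, by simpa [hl] using hy⟩
  refine ⟨fun a ha => ?_, fun a ha => ?_, fun a a' ha ha' he => ?_⟩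
  · obtain ⟨y, rfl, hy⟩ := hy ha
    rw [hc y hy, hT y hy]
  · by_cases hm : a ∈ cs
    · obtain ⟨y, hy, rfl⟩ := List.getElem_of_mem hm
      exact ⟨.var y, by rwa [← hT y hy], hc y hy⟩
    · refine absurd ?_ ha
      cases hA : Δ a with
      | none => simp [Typing.toTyp, hA]
      | some A => rw [Typing.toTyp_eq hA, hf a hm A hA, LType.tree_fin]
  · obtain ⟨y, rfl, hy₁⟩ := hy ha
    obtain ⟨y', rfl, hy₂⟩ := hy ha'
    rw [hc y hy₁, hc y' hy₂] at he
    rw [(hn.getElem_inj_iff).1 he]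

theorem Typed.wt {Γ : List Srt} {Ξ : List (List Srt × List LType)} {P : Proc} {Δ : Typing}
    (h : Typed Γ Ξ P Δ) : WT .full (toPEnv Ξ) P Δ.toTyp := by
  induction h with
  | sel hc hv hP hp hδ ih =>
    refine ⟨trivial, ?_, fun i => ?_⟩
    · rw [Typing.toTyp_add, Function.update_self, LType.tree_sel_nil]
    · have := ih i
      rw [Typing.toTyp_add] at this ⊢
      rwa [Function.update_self, LType.child_tree_sel, Function.update_idem]
  | bra hc hP ih =>
    refine ⟨trivial, ?_, fun i => ?_⟩
    · rw [Typing.toTyp_add, Function.update_self, LType.tree_bra_nil]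
    · have := ih i
      rw [Typing.toTyp_add] at this ⊢
      rwa [Function.update_self, LType.child_tree_bra, Function.update_idem]
  | @nil _ _ Δ h =>
    intro c
    cases hc : Δ c with
    | none => simp [Typing.toTyp, hc]
    | some T => rw [Typing.toTyp_eq hc, h c T hc, LType.tree_fin]
  | par _ _ hs ih₁ ih₂ =>
    refine ⟨_, _, fun c => ?_, ih₁, ih₂⟩
    rcases hs c with ⟨h, h'⟩ | ⟨h, h'⟩
    · exact Or.inl ⟨by simp [Typing.toTyp, h], by simp [Typing.toTyp, h']⟩
    · exact Or.inr ⟨by simp [Typing.toTyp, h], by simp [Typing.toTyp, h']⟩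
  | nu hG hT _ ih => exact ⟨_, hG.coherent hT, Typing.toTyp_addSession _ _ _ ▸ ih⟩
  | @defn Γ Ξ n m B P S T Δ hS hT _ _ ih₁ ih₂ =>
    rw [toPEnv_cons] at ih₁ ih₂
    rw [Typing.toTyp_params] at ih₁
    simp only [hS] at ih₁ ih₂
    refine ⟨some (T.map LType.tree), fun T' hT' => ?_, ih₂⟩
    obtain rfl : T.map LType.tree = T' := by simpa using hT'
    exact ⟨by simpa using hT, ih₁⟩
  | @call Γ Ξ X v c S T Δ hX hv hn hc hf =>
    refine ⟨trivial, T.map LType.tree, ?_, by simpa using hc.length_eq.symm, carry_call hn hc hf⟩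
    simp [toPEnv, hX, hv.length_eq]
  -- Equivalent types have equal trees, so the typing by trees does not change.
  | @conv Γ Ξ P c Δ T T' _ hc he ih =>
    rw [Typing.toTyp_add, ← he.tree_eq, ← Typing.toTyp_eq hc, Function.update_eq_self]
    exact ih

/-! ### Preservation of the invariant -/

/-- The labels of enabled interactions agree. -/
def Safe (Δ : Typ) : Prop := ∀ s r₁ r₂ I J, Δ (.role s r₁) [] = .sel r₂ I →
  Δ (.role s r₂) [] = .bra r₁ J → I = J

/-- `Δ'` results from `Δ` by an interaction of two roles of a session. -/
inductive Advance (Δ : Typ) : Typ → Prop where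
  | mk (s r₁ r₂ I J l) : Δ (.role s r₁) [] = .sel r₂ I → Δ (.role s r₂) [] = .bra r₁ J → l ∈ I →
      Advance Δ (Function.update (Function.update Δ (.role s r₁) (child (Δ (.role s r₁)) l))
        (.role s r₂) (child (Δ (.role s r₂)) l))

theorem Disj.safe {Δ Δ₁ Δ₂ : Typ} (hd : Disj Δ Δ₁ Δ₂) (h : Safe Δ) : Safe Δ₁ := by
  intro s r₁ r₂ I J h₁ h₂
  refine h s r₁ r₂ I J ?_ ?_
  · rwa [(hd.left (ne_finT_of_sel h₁)).1]
  · rwa [(hd.left (ne_finT_of_bra h₂)).1]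

theorem Advance.disj {Δ Δ₁ Δ₂ Δ₁' : Typ} (hd : Disj Δ Δ₁ Δ₂) (h : Advance Δ₁ Δ₁') :
    ∃ Δ', Advance Δ Δ' ∧ Disj Δ' Δ₁' Δ₂ := by
  obtain ⟨s, r₁, r₂, I, J, l, h₁, h₂, hl⟩ := h
  have hn₁ := ne_finT_of_sel h₁
  have hn₂ := ne_finT_of_bra h₂
  have e₁ := (hd.left hn₁).1
  have e₂ := (hd.left hn₂).1
  refine ⟨_, ⟨s, r₁, r₂, I, J, l, by rwa [e₁], by rwa [e₂], hl⟩, ?_⟩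
  rw [e₁, e₂]
  refine (hd.update hn₁ _).update ?_ _
  -- A tree cannot start with both a selection and a branching, so the two channels differ.
  by_cases e : Chan.role s r₂ = .role s r₁
  · rw [e, h₁] at h₂
    simp at h₂
  · simpa [e] using hn₂

theorem safe_addSess {Δ : Typ} {U : Role → LTree} (h : Safe Δ) (hU : Coherent U) :
    Safe (addSess Δ U) := by
  rintro (_ | s) r₁ r₂ I J h₁ h₂
  · exact (hU.step h₁ h₂).1
  · exact h s r₁ r₂ I J h₁ h₂

theorem addSess_update_zero (Δ : Typ) (U : Role → LTree) (r : Role) (t : LTree) :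
    Function.update (addSess Δ U) (.role 0 r) t = addSess Δ (Function.update U r t) := by
  funext c
  rcases c with y | ⟨_ | s, r'⟩
  · simp [addSess]
  · by_cases e : r' = r <;> simp [addSess, e]
  · simp [addSess]

theorem addSess_update_succ (Δ : Typ) (U : Role → LTree) (s : ℕ) (r : Role) (t : LTree) :
    Function.update (addSess Δ U) (.role (s + 1) r) t =
      addSess (Function.update Δ (.role s r) t) U := by
  funext c
  rcases c with y | ⟨_ | s', r'⟩
  · simp [addSess]
  · simp [addSess]
  · by_cases e : Chan.role s' r' = .role s r
    · have e' : Chan.role (s' + 1) r' = .role (s + 1) r := by simp_all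
      simp [addSess, e, e']
    · have e' : Chan.role (s' + 1) r' ≠ .role (s + 1) r := by simp_all
      simp [addSess, e, e']

/-- An interaction on the new session is absorbed by its assignment, which stays coherent; any other
leaves the assignment alone. -/
theorem Advance.addSess {Δ Δ' : Typ} {U : Role → LTree} (hU : Coherent U)
    (h : Advance (addSess Δ U) Δ') :
    (∃ U', Coherent U' ∧ Δ' = addSess Δ U') ∨ ∃ Δ'', Advance Δ Δ'' ∧ Δ' = addSess Δ'' U := by
  obtain ⟨s, r₁, r₂, I, J, l, h₁, h₂, hl⟩ := h
  cases s with
  | zero =>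
    left
    refine ⟨_, (hU.step h₁ h₂).2 l hl, ?_⟩
    rw [addSess_update_zero, addSess_update_zero]
    rfl
  | succ s =>
    right
    refine ⟨_, ⟨s, r₁, r₂, I, J, l, h₁, h₂, hl⟩, ?_⟩
    rw [addSess_update_succ, addSess_update_succ]
    rfl

/-- Whenever `P` satisfies the invariant, `Q` does, possibly after an interaction. -/
def Preserves (P Q : Proc) : Prop := ∀ Ξ Δ, Safe Δ → WT .top Ξ P Δ →
  ∃ Δ', (Δ' = Δ ∨ Advance Δ Δ') ∧ WT .top Ξ Q Δ'

theorem Preserves.parL {P P' : Proc} (h : Preserves P P') (Q : Proc) :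
    Preserves (.par P Q) (.par P' Q) := by
  rintro Ξ Δ hs ⟨Δ₁, Δ₂, hd, h₁, h₂⟩
  obtain ⟨Δ₁', rfl | ha, h₁'⟩ := h Ξ Δ₁ (hd.safe hs) h₁
  · exact ⟨Δ, Or.inl rfl, Δ₁', Δ₂, hd, h₁', h₂⟩
  · obtain ⟨Δ', ha', hd'⟩ := ha.disj hd
    exact ⟨Δ', Or.inr ha', Δ₁', Δ₂, hd', h₁', h₂⟩

theorem Preserves.struct {P P' Q Q' : Proc} (hP : SCong P P') (h : Preserves P' Q')
    (hQ : SCong Q Q') : Preserves P Q := by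
  intro Ξ Δ hs hw
  obtain ⟨Δ', ha, hw'⟩ := h Ξ Δ hs (hP.wt_iff.1 hw)
  exact ⟨Δ', ha, hQ.wt_iff.2 hw'⟩

theorem Preserves.fill {P P' : Proc} (h : Preserves P P') (E : ECtx) :
    Preserves (E.fill P) (E.fill P') := by
  induction E with
  | hole => exact h
  | parL E Q ih => exact ih.parL Q
  | parR Q E ih => exact .struct (.parComm _ _) (ih.parL Q) (.parComm _ _)
  | nu G E ih =>
    rintro Ξ Δ hs ⟨U, hU, hw⟩
    obtain ⟨Δ', rfl | ha, hw'⟩ := ih Ξ _ (safe_addSess hs hU) hw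
    · exact ⟨Δ, Or.inl rfl, U, hU, hw'⟩
    · rcases ha.addSess hU with ⟨U', hU', rfl⟩ | ⟨Δ'', ha', rfl⟩
      · exact ⟨Δ, Or.inl rfl, U', hU', hw'⟩
      · exact ⟨Δ'', Or.inr ha', U, hU, hw'⟩
  | defn n k B E ih =>
    rintro Ξ Δ hs ⟨e, he, hw⟩
    obtain ⟨Δ', ha, hw'⟩ := ih _ Δ hs hw
    exact ⟨Δ', ha, e, he, hw'⟩

/-- Continuations and bodies of definitions obey `inner`. When they become active they inherit the
at most one channel of the prefix or call that released them, hence obey `top`. -/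
theorem Step.preserves {P P' : Proc} {tl : TLabel} {p : ℝ} (h : Step P tl p P') :
    Preserves P P' := by
  induction h with
  | com s r₁ r₂ J I hJ hI p v P P' hJI k hk =>
    rintro Ξ Δ hs ⟨Δ₁, Δ₂, hd, ⟨hl₁, h₁, hw₁⟩, hl₂, h₂, hw₂⟩
    have hn₁ := ne_finT_of_sel h₁
    have hn₂ := ne_finT_of_bra h₂
    have e₁ := (hd.left hn₁).1
    have e₂ := (hd.right hn₂).1
    refine ⟨_, Or.inr ⟨s, r₁, r₂, J, I, k, by rwa [e₁], by rwa [e₂], hk⟩, _, _, ?_,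
      (hw₁ ⟨k, hk⟩).top_of_inner (Single.update hl₁ hn₁ _),
      ((hw₂ ⟨k, hJI hk⟩).subst (Carry.ident ?_)).top_of_inner (Single.update hl₂ hn₂ _)⟩
    · rw [e₁, e₂]
      exact ((hd.update hn₁ _).symm.update hn₂ _).symm
    -- A communication substitutes values only and fixes all channels.
    · rintro (y | ⟨s, r⟩) - <;> rfl
  | call n m B Q v c hv hc =>
    rintro Ξ Δ hs ⟨e, he, Δ₁, Δ₂, hd, ⟨hl, T, hX, hT, hcar⟩, hw⟩
    refine ⟨Δ, Or.inl rfl, e, he, Δ₁, Δ₂, hd, ?_, hw⟩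
    cases e with
    | none => simp [PEnv.cons] at hX
    | some T' =>
      obtain ⟨-, rfl⟩ : n = v.length ∧ T' = T := by simpa [PEnv.cons] using hX
      exact WT.top_of_inner ((he T' rfl).2.subst hcar) hl
  | ctxt E _ ih => exact ih.fill E
  | struct hP _ hQ ih => exact .struct hP ih hQ

theorem Advance.not_fin {Δ Δ' : Typ} (h : Advance Δ Δ') : ∃ c, Δ c ≠ finT := by
  obtain ⟨s, r₁, r₂, I, J, l, h₁, h₂, hl⟩ := h
  exact ⟨_, ne_finT_of_sel h₁⟩

/-- A typing with nothing in use cannot advance, so each step keeps it. -/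
theorem Steps.wt {P P' : Proc} {tls : List TLabel} {p : ℝ} (h : Steps P tls p P') {Ξ : PEnv}
    (hw : WT .top Ξ P fun _ => finT) : WT .top Ξ P' fun _ => finT := by
  induction h with
  | refl => exact hw
  | head hs _ ih =>
    obtain ⟨Δ', rfl | ha, hw'⟩ := hs.preserves Ξ _ (fun _ _ _ _ _ h => by simp [finT] at h) hw
    · exact ih hw'
    · obtain ⟨c, hc⟩ := ha.not_fin
      exact absurd rfl hc


/-! ### Normal forms -/

/-- Selections and branchings. -/
inductive IsComm : Proc → Prop where
  | sel (c r I hI p v P) : IsComm (.sel c r I hI p v P)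
  | bra (c r I hI P) : IsComm (.bra c r I hI P)

/-- Selections, branchings and calls. -/
inductive IsLeaf : Proc → Prop where
  | comm {P} : IsComm P → IsLeaf P
  | call (X v c) : IsLeaf (.call X v c)

/-- Parallel compositions of processes that satisfy `A`. -/
inductive Flat (A : Proc → Prop) : Proc → Prop where
  | nil : Flat A .nil
  | cons {L P} : A L → Flat A P → Flat A (.par L P)

/-- Parallel compositions of processes that satisfy `A`, below definitions. -/
inductive DefFlat (A : Proc → Prop) : Proc → Prop where
  | flat {P} : Flat A P → DefFlat A P
  | defn {P} (n k B) : DefFlat A P → DefFlat A (.defn n k B P)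

/-- Normal forms: restrictions, below them definitions, and below them a parallel composition of
prefixes and calls. -/
inductive Normal : Proc → Prop where
  | base {P} : DefFlat IsLeaf P → Normal P
  | nu {P} (G) : Normal P → Normal (.nu G P)

theorem IsLeaf.ren {P : Proc} (h : IsLeaf P) (f g : ℕ → ℕ) : IsLeaf (P.ren f g) := by
  cases h with
  | comm h =>
    cases h with
    | sel => exact .comm (.sel ..)
    | bra => exact .comm (.bra ..)
  | call => exact .call ..

theorem Flat.ren {P : Proc} (h : Flat IsLeaf P) (f g : ℕ → ℕ) : Flat IsLeaf (P.ren f g) := by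
  induction h with
  | nil => exact .nil
  | cons hL _ ih => exact .cons (hL.ren f g) ih

theorem DefFlat.ren {P : Proc} (h : DefFlat IsLeaf P) (f g : ℕ → ℕ) :
    DefFlat IsLeaf (P.ren f g) := by
  induction h generalizing f g with
  | flat h => exact .flat (h.ren f g)
  | defn n k B _ ih => exact .defn _ _ _ (ih _ _)

theorem Normal.ren {P : Proc} (h : Normal P) (f g : ℕ → ℕ) : Normal (P.ren f g) := by
  induction h generalizing f g with
  | base h => exact .base (h.ren f g)
  | nu G _ ih => exact .nu G (ih _ _)

theorem SCong.parCongL {P P' : Proc} (h : SCong P P') (Q : Proc) : SCong (.par P Q) (.par P' Q) :=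
  .par h (.refl Q)

theorem SCong.parCongR (P : Proc) {Q Q' : Proc} (h : SCong Q Q') : SCong (.par P Q) (.par P Q') :=
  .par (.refl P) h

theorem SCong.parLeft (P Q R : Proc) : SCong (.par P (.par Q R)) (.par Q (.par P R)) :=
  (SCong.parAssoc P Q R).symm.trans (((SCong.parComm P Q).parCongL R).trans (.parAssoc Q P R))

theorem Flat.par {A : Proc → Prop} {P Q : Proc} (hP : Flat A P) (hQ : Flat A Q) :
    ∃ N, Flat A N ∧ SCong (.par P Q) N := by
  induction hP with
  | nil => exact ⟨Q, hQ, (SCong.parComm _ _).trans (.parNil Q)⟩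
  | cons hL _ ih =>
    obtain ⟨N, hN, h⟩ := ih
    exact ⟨_, .cons hL hN, (SCong.parAssoc _ _ _).trans (.parCongR _ h)⟩

/-- Definitions are pulled out of the left component and then of the right one, each time shifting
the process variables of the other component. -/
theorem DefFlat.par {P Q : Proc} (hP : DefFlat IsLeaf P) (hQ : DefFlat IsLeaf Q) :
    ∃ N, DefFlat IsLeaf N ∧ SCong (.par P Q) N := by
  induction hP generalizing Q with
  | flat hP =>
    rename_i P
    induction hQ generalizing P with
    | flat hQ =>
      obtain ⟨N, hN, h⟩ := hP.par hQ
      exact ⟨N, .flat hN, h⟩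
    | @defn Q n k B _ ih =>
      obtain ⟨N, hN, h⟩ := ih (hP.ren id Nat.succ)
      exact ⟨_, .defn n k B hN, (SCong.parComm _ _).trans ((SCong.defPar n k B Q P).symm.trans
        (.defn n k (.refl B) ((SCong.parComm _ _).trans h)))⟩
  | @defn P n k B _ ih =>
    obtain ⟨N, hN, h⟩ := ih (hQ.ren id Nat.succ)
    exact ⟨_, .defn n k B hN, (SCong.defPar n k B P Q).symm.trans (.defn n k (.refl B) h)⟩

theorem Normal.par {P Q : Proc} (hP : Normal P) (hQ : Normal Q) :
    ∃ N, Normal N ∧ SCong (.par P Q) N := by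
  induction hP generalizing Q with
  | base hP =>
    rename_i P
    induction hQ generalizing P with
    | base hQ =>
      obtain ⟨N, hN, h⟩ := hP.par hQ
      exact ⟨N, .base hN, h⟩
    | @nu Q G _ ih =>
      obtain ⟨N, hN, h⟩ := ih (hP.ren Nat.succ id)
      exact ⟨_, .nu G hN, (SCong.parComm _ _).trans ((SCong.nuPar G Q P).trans
        (.nu G ((SCong.parComm _ _).trans h)))⟩
  | @nu P G _ ih =>
    obtain ⟨N, hN, h⟩ := ih (hQ.ren Nat.succ id)
    exact ⟨_, .nu G hN, (SCong.nuPar G P Q).trans (.nu G h)⟩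

theorem Normal.defn {P : Proc} (hP : Normal P) (n k : ℕ) (B : Proc) :
    ∃ N, Normal N ∧ SCong (.defn n k B P) N := by
  induction hP generalizing B with
  | base hP => exact ⟨_, .base (.defn n k B hP), .refl _⟩
  | nu G _ ih =>
    obtain ⟨N, hN, h⟩ := ih (B.renS Nat.succ)
    exact ⟨_, .nu G hN, (SCong.defNu n k B G _).trans (.nu G h)⟩

theorem IsLeaf.exists_normal {P : Proc} (h : IsLeaf P) : ∃ N, Normal N ∧ SCong P N :=
  ⟨_, .base (.flat (.cons h .nil)), (SCong.parNil P).symm⟩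

theorem exists_normal (P : Proc) : ∃ N, Normal N ∧ SCong P N := by
  induction P with
  | nil => exact ⟨_, .base (.flat .nil), .refl _⟩
  | par P Q ihP ihQ =>
    obtain ⟨N, hN, h⟩ := ihP
    obtain ⟨N', hN', h'⟩ := ihQ
    obtain ⟨M, hM, h''⟩ := hN.par hN'
    exact ⟨M, hM, (SCong.par h h').trans h''⟩
  | sel => exact (IsLeaf.comm (.sel ..)).exists_normal
  | bra => exact (IsLeaf.comm (.bra ..)).exists_normal
  | nu G P ih =>
    obtain ⟨N, hN, h⟩ := ih
    exact ⟨_, .nu G hN, .nu G h⟩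
  | defn n k B P _ ih =>
    obtain ⟨N, hN, h⟩ := ih
    obtain ⟨M, hM, h'⟩ := hN.defn n k B
    exact ⟨M, hM, (SCong.defn n k (.refl B) h).trans h'⟩
  | call => exact (IsLeaf.call ..).exists_normal

/-! ### Progress -/

/-- The process has a transition. -/
def CanStep (P : Proc) : Prop := ∃ tl p P', Step P tl p P'

theorem CanStep.fill {P : Proc} (h : CanStep P) (E : ECtx) : CanStep (E.fill P) := by
  obtain ⟨tl, p, P', h⟩ := h
  exact ⟨_, _, _, h.ctxt E⟩

theorem CanStep.congr {P Q : Proc} (h : CanStep Q) (hPQ : SCong P Q) : CanStep P := by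
  obtain ⟨tl, p, Q', h⟩ := h
  exact ⟨_, _, _, .struct hPQ h (.refl _)⟩

theorem stuck_iff {P : Proc} : Stuck P ↔ ¬ CanStep P := by
  simp [Stuck, CanStep]

theorem Flat.comm_or_call {P : Proc} (h : Flat IsLeaf P) :
    Flat IsComm P ∨ ∃ X v c R, SCong P (.par (.call X v c) R) := by
  induction h with
  | nil => exact Or.inl .nil
  | cons hL _ ih =>
    cases hL with
    | comm hL =>
      rcases ih with ih | ⟨X, v, c, R, h⟩
      · exact Or.inl (.cons hL ih)
      · exact Or.inr ⟨X, v, c, _, (SCong.parCongR _ h).trans (.parLeft _ _ _)⟩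
    | call X v c => exact Or.inr ⟨X, v, c, _, .refl _⟩

theorem call_renX (X : ℕ) (v : List Val) (c : List Chan) (g : ℕ → ℕ) :
    (Proc.call X v c).renX g = .call (g X) v c := by
  have hv : Val.ren id = id := by funext x; cases x <;> rfl
  have hc : Chan.ren id = id := by funext x; cases x <;> rfl
  simp [Proc.renX, Proc.ren, hv, hc]

/-- The invariant gives every called variable a type of the right arity, so a call of an enclosing
definition can fire. Only calls of outer variables remain, and an empty environment excludes those.
-/
theorem DefFlat.comm_or_call {P : Proc} (h : DefFlat IsLeaf P) {Ξ : PEnv} {Δ : Typ}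
    (hw : WT .top Ξ P Δ) :
    CanStep P ∨ DefFlat IsComm P ∨ ∃ X v c R, SCong P (.par (.call X v c) R) := by
  induction h generalizing Ξ with
  | flat h =>
    rcases h.comm_or_call with h | h
    · exact Or.inr (Or.inl (.flat h))
    · exact Or.inr (Or.inr h)
  | @defn P n k B _ ih =>
    obtain ⟨e, he, hw⟩ := hw
    rcases ih hw with h | h | ⟨X, v, c, R, h⟩
    · exact Or.inl (h.fill (.defn n k B .hole))
    · exact Or.inr (Or.inl (.defn n k B h))
    · have hP := SCong.defn n k (.refl B) h
      cases X with
      | zero =>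
        left
        obtain ⟨Δ₁, Δ₂, -, ⟨-, T, hX, hT, -⟩, -⟩ := h.wt_iff.1 hw
        cases e with
        | none => simp [PEnv.cons] at hX
        | some T' =>
          obtain ⟨hn, rfl⟩ : n = v.length ∧ T' = T := by simpa [PEnv.cons] using hX
          exact CanStep.congr ⟨_, _, _, .call n k B R v c hn.symm (hT ▸ (he T' rfl).1)⟩ hP
      | succ X =>
        right; right
        refine ⟨X, v, c, .defn n k B R, hP.trans ?_⟩
        -- A call of `X + 1` below the definition is a shifted call of `X`, so it can leave the
        -- scope.
        have h' := SCong.defPar n k B R (.call X v c)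
        rw [call_renX] at h'
        exact (SCong.defn n k (.refl B) (.parComm _ _)).trans (h'.trans (.parComm _ _))

theorem Flat.exists_thread {P : Proc} (h : Flat IsComm P) {Ξ : PEnv} {Δ : Typ} {c : Chan}
    (hw : WT .top Ξ P Δ) (hc : Δ c ≠ finT) :
    ∃ L R Δ₁ Δ₂, SCong P (.par L R) ∧ IsComm L ∧ Flat IsComm R ∧ Disj Δ Δ₁ Δ₂ ∧
      WT .top Ξ L Δ₁ ∧ WT .top Ξ R Δ₂ ∧ Δ₁ c ≠ finT := by
  induction h generalizing Δ with
  | nil => exact absurd (hw c) hc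
  | @cons L P hL hP ih =>
    obtain ⟨Δ₁, Δ₂, hd, h₁, h₂⟩ := hw
    rcases hd.exists_ne hc with hc | hc
    · exact ⟨L, P, Δ₁, Δ₂, .refl _, hL, hP, hd, h₁, h₂, hc⟩
    · obtain ⟨L', R, D₁, D₂, hs, hL', hR, hd', h₁', h₂', hc'⟩ := ih h₂ hc
      obtain ⟨D, hd₁, hd₂⟩ := hd.symm.assoc hd'
      exact ⟨L', .par L R, D₁, D, (SCong.parCongR L hs).trans (.parLeft _ _ _), hL', .cons hL hR,
        hd₁, h₁', ⟨Δ₁, D₂, hd₂.symm, h₁, h₂'⟩, hc'⟩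

theorem IsComm.single {L : Proc} (h : IsComm L) {Ξ : PEnv} {Δ : Typ} (hw : WT .top Ξ L Δ) :
    Single Δ := by
  cases h with
  | sel => exact hw.1
  | bra => exact hw.1

theorem IsComm.eq_sel {L : Proc} (h : IsComm L) {Ξ : PEnv} {Δ : Typ} (hw : WT .top Ξ L Δ)
    {c : Chan} {r : Role} {I : Finset Label} (hc : Δ c [] = .sel r I) :
    ∃ hI p v P, L = .sel c r I hI p v P := by
  cases h with
  | sel c' r' I' hI p v P =>
    obtain ⟨hs, h', -⟩ := hw
    obtain rfl := hs c' c (ne_finT_of_sel h') (ne_finT_of_sel hc)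
    rw [h'] at hc
    cases hc
    exact ⟨hI, p, v, P, rfl⟩
  | bra c' r' I' hI P =>
    obtain ⟨hs, h', -⟩ := hw
    obtain rfl := hs c' c (ne_finT_of_bra h') (ne_finT_of_sel hc)
    rw [h'] at hc
    cases hc

theorem IsComm.eq_bra {L : Proc} (h : IsComm L) {Ξ : PEnv} {Δ : Typ} (hw : WT .top Ξ L Δ)
    {c : Chan} {r : Role} {I : Finset Label} (hc : Δ c [] = .bra r I) :
    ∃ hI P, L = .bra c r I hI P := by
  cases h with
  | sel c' r' I' hI p v P =>
    obtain ⟨hs, h', -⟩ := hw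
    obtain rfl := hs c' c (ne_finT_of_sel h') (ne_finT_of_bra hc)
    rw [h'] at hc
    cases hc
  | bra c' r' I' hI P =>
    obtain ⟨hs, h', -⟩ := hw
    obtain rfl := hs c' c (ne_finT_of_bra h') (ne_finT_of_bra hc)
    rw [h'] at hc
    cases hc
    exact ⟨hI, P, rfl⟩

/-- The thread that uses `s[r₁]` uses no other channel, so it is the expected selection. The channel
`s[r₂]` has a different tree and thus belongs to another thread, which is the branching. The
invariant gives both the label set `I`. -/
theorem Flat.canStep {P : Proc} (h : Flat IsComm P) {Ξ : PEnv} {Δ : Typ} (hw : WT .top Ξ P Δ)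
    {s : ℕ} {r₁ r₂ : Role} {I : Finset Label} (hm : Matched (fun r => Δ (.role s r)) r₁ r₂ I) :
    CanStep P := by
  have hsel : Δ (.role s r₁) [] = .sel r₂ I := hm.sel
  have hbra : Δ (.role s r₂) [] = .bra r₁ I := hm.bra
  obtain ⟨L, R, Δ₁, Δ₂, hPs, hL, hR, hd, hwL, hwR, hc₁⟩ := h.exists_thread hw (ne_finT_of_sel hsel)
  have hsel' := hsel
  rw [(hd.left hc₁).1] at hsel
  have hc₂ : Δ₁ (.role s r₂) = finT := by
    by_contra hn
    have e := hL.single hwL _ _ hc₁ hn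
    rw [← e, hsel'] at hbra
    cases hbra
  rw [hd.eq_of_left hc₂] at hbra
  obtain ⟨L', R', D₁, D₂, hRs, hL', -, hd', hwL', -, hc₃⟩ :=
    hR.exists_thread hwR (ne_finT_of_bra hbra)
  rw [(hd'.left hc₃).1] at hbra
  obtain ⟨hI, p, v, P₁, rfl⟩ := hL.eq_sel hwL hsel
  obtain ⟨hI', P₂, rfl⟩ := hL'.eq_bra hwL' hbra
  obtain ⟨k, hk⟩ := hI
  have hstep := Step.com s r₁ r₂ I I ⟨k, hk⟩ hI' p v P₁ P₂ (Finset.Subset.refl I) k hk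
  exact (CanStep.fill ⟨_, _, _, hstep⟩ (.parL .hole R')).congr
    (hPs.trans ((SCong.parCongR _ hRs).trans (SCong.parAssoc _ _ _).symm))

theorem DefFlat.canStep {P : Proc} (h : DefFlat IsComm P) {Ξ : PEnv} {Δ : Typ}
    (hw : WT .top Ξ P Δ) {s : ℕ} {r₁ r₂ : Role} {I : Finset Label}
    (hm : Matched (fun r => Δ (.role s r)) r₁ r₂ I) : CanStep P := by
  induction h generalizing Ξ with
  | flat h => exact h.canStep hw hm
  | defn n k B _ ih =>
    obtain ⟨e, -, hw⟩ := hw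
    exact (ih hw).fill (.defn n k B .hole)

theorem DefFlat.scong_nil {P : Proc} (h : DefFlat IsComm P) {Ξ : PEnv} {Δ : Typ}
    (hw : WT .top Ξ P Δ) (hΔ : ∀ c, Δ c = finT) : SCong P .nil := by
  induction h generalizing Ξ with
  | flat h =>
    cases h with
    | nil => exact .refl _
    | cons hL _ =>
      obtain ⟨Δ₁, Δ₂, hd, h₁, -⟩ := hw
      cases hL with
      | sel =>
        have hne := ne_finT_of_sel h₁.2.1
        exact absurd (hΔ _) ((hd.left hne).1 ▸ hne)
      | bra =>
        have hne := ne_finT_of_bra h₁.2.1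
        exact absurd (hΔ _) ((hd.left hne).1 ▸ hne)
  | defn n k B _ ih =>
    obtain ⟨e, -, hw⟩ := hw
    exact (SCong.defn n k (.refl B) (ih hw)).trans (.defNil n k B)

/-- Passing below the restrictions collects coherent sessions. At the bottom an unfinished session
would allow a communication, and a free call has no type in the empty environment; so nothing is in
use and no thread is left. -/
theorem Normal.scong_nil {P : Proc} (h : Normal P) (hst : ¬ CanStep P) {Δ : Typ}
    (hc : ∀ s, Coherent fun r => Δ (.role s r)) (hv : ∀ y, Δ (.var y) = finT)
    (hw : WT .top (fun _ => none) P Δ) : SCong P .nil := by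
  induction h generalizing Δ with
  | base h =>
    rcases h.comm_or_call hw with h | h | ⟨X, v, c, R, h⟩
    · exact absurd h hst
    · refine h.scong_nil hw ?_
      rintro (y | ⟨s, r⟩)
      · exact hv y
      · rcases (hc s).progress with hf | ⟨r₁, r₂, I, hm⟩
        · exact hf r
        · exact absurd (h.canStep hw hm) hst
    · obtain ⟨_, _, _, ⟨-, T, hX, -⟩, -⟩ := h.wt_iff.1 hw
      cases hX
  | nu G _ ih =>
    obtain ⟨U, hU, hw⟩ := hw
    refine (SCong.nu G (ih (Δ := addSess Δ U) (fun hs => hst (hs.fill (.nu G .hole)))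
      ?_ hv hw)).trans (.nuNil G)
    rintro (_ | s)
    · exact hU
    · exact hc s

theorem scong_nil_of_stuck {P : Proc} (hst : Stuck P)
    (hw : WT .top (fun _ => none) P fun _ => finT) : SCong P .nil := by
  obtain ⟨N, hN, h⟩ := exists_normal P
  exact h.trans (hN.scong_nil (fun hs => stuck_iff.1 hst (hs.congr h))
    (fun _ => .of_fin fun _ => rfl) (fun _ => rfl) (h.wt_iff.1 hw))

/-! ### Deadlock freedom -/

/-- In each thread `OnlyOn` leaves at most one channel with role in use, and `hv` excludes channel
variables. -/
theorem WT.top_of_threads {l : List Proc} (hl : ∀ P ∈ l, ∃ r, P.OnlyOn 0 r) {Ξ : PEnv} {Δ : Typ}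
    (hv : ∀ y, Δ (.var y) = finT) (hw : WT .full Ξ (l.foldr .par .nil) Δ) :
    WT .top Ξ (l.foldr .par .nil) Δ := by
  induction l generalizing Δ with
  | nil => exact hw
  | cons P l ih =>
    obtain ⟨Δ₁, Δ₂, hd, h₁, h₂⟩ := hw
    obtain ⟨r, hr⟩ := hl P (by simp)
    obtain ⟨h₁, hu⟩ := h₁.inner_of_onlyOn hr
    have hv₁ : ∀ y, Δ₁ (.var y) = finT := fun y => by
      by_contra hn
      exact hn ((hd.left hn).1 ▸ hv y)
    have hv₂ : ∀ y, Δ₂ (.var y) = finT := fun y => by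
      by_contra hn
      exact hn ((hd.right hn).1 ▸ hv y)
    refine ⟨Δ₁, Δ₂, hd, h₁.top_of_inner ?_,
      ih (fun Q hQ => hl Q (List.mem_cons_of_mem _ hQ)) hv₂ h₂⟩
    rintro (y | ⟨s, q⟩) (y' | ⟨s', q'⟩) hc hc'
    · exact absurd (hv₁ y) hc
    · exact absurd (hv₁ y) hc
    · exact absurd (hv₁ y') hc'
    · obtain ⟨rfl, rfl⟩ := hu s q hc
      obtain ⟨rfl, rfl⟩ := hu s' q' hc'
      rfl

end PMST

theorem theorem4 (P : PMST.Proc) (G : PMST.GType) (n : ℕ)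
    (r : Fin n → PMST.Role) (Q : Fin n → PMST.Proc)
    (hP : PMST.Typed [] [] P PMST.Typing.empty)
    (hPQ : PMST.SCong P (PMST.Proc.nu G (PMST.Proc.parAll Q)))
    (hQ : ∀ i, (Q i).OnlyOn 0 (r i)) :
    PMST.DeadlockFree P := by
  have hw : PMST.WT .full (fun _ => none) P fun _ => PMST.finT := hP.wt
  -- Congruence transports the invariant and not the typing, so `U` is coherent without being tied
  -- to `G`.
  obtain ⟨U, hU, hw⟩ := hPQ.wt_iff.1 hw
  have hw' : PMST.WT .top (fun _ => none) (.nu G (PMST.Proc.parAll Q)) fun _ => PMST.finT :=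
    ⟨U, hU, PMST.WT.top_of_threads (fun R hR => by
      obtain ⟨i, rfl⟩ := (List.mem_ofFn' _ _).1 hR
      exact ⟨r i, hQ i⟩) (fun _ => rfl) hw⟩
  exact fun tls p P' hs hst => PMST.scong_nil_of_stuck hst (hs.wt (hPQ.wt_iff.2 hw'))
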